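/- **Setting.** Let $x_1,\dots,x_K\in\mathbb R^d$ ($d\ge 1$) be arm feature vectors with $\|x_i\|_2\le 1$, let $\theta_*\in\mathbb R^d$, and let $b:\mathbb R\to\mathbb R$ be twice continuously differentiable with mean function $\mu=\dot b$ and $\dot\mu>0$. Let $n\ge 7$. In round $t\in\{1,\dots,n\}$ the reward $Y_{i,t}$ of arm $i$ is drawn, independently of the past and of the arm chosen in that round, from a fixed distribution with mean $\mu_i=\mu(x_i^\top\theta_*)$ and $\sigma^2$-sub-Gaussian noise: $\mathbb E\exp[\lambda(Y_{i,t}-\mu_i)]\le\exp[\lambda^2\sigma^2/2]$ for all $\lambda\in\mathbb R$, where $\sigma>0$ (in a GLM this distribution is from the exponential family with log-partition function $b$; only the stated properties are needed). Arm $1$ is the unique optimal arm: $\mu_1>\mu_i$ for $i>1$. Let $\Delta_i=\mu_1-\mu_i$ and $\Delta_{\max}=\max_i\Delta_i$. Let $I_t$ be the arm pulled in round $t$, $X_t=x_{I_t}$, $Y_t=Y_{I_t,t}$, $G_t=\sum_{\ell=1}^{t-1}X_\ell X_\ell^\top$, and $R(n)=\sum_{i=2}^K\Delta_i\,\mathbb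 E\big[\sum_{t=1}^n\mathbf 1\{I_t=i\}\big]$. Let $$\dot\mu_{\min}=\min_{\|x\|_2\le1,\ \|\theta-\theta_*\|_2\le1}\dot\mu(x^\top\theta),\qquad \dot\mu_{\max}=\sup_{\|x\|_2\le1,\ \theta\in\mathbb R^d}\dot\mu(x^\top\theta),$$ and assume $\dot\mu_{\max}<\infty$. **GLM-FPL.** In rounds $t\le\tau$, where $1\le\tau\le n$, the arms are chosen by any exploration rule that does not anticipate the rewards of the round. In round $t\in\{\tau+1,\dots,n\}$ the algorithm draws fresh $Z_1,\dots,Z_{t-1}\sim\mathcal N(0,a^2)$, independent of each other and of the history $(I_\ell,Y_\ell)_{\ell<t}$, and sets $$\tilde\theta_t\in\arg\min_{\theta\in\mathbb R^d}\ \sum_{\ell=1}^{t-1}\big(b(X_\ell^\top\theta)-(Y_\ell+Z_\ell)X_\ell^\top\theta-c(Y_\ell+Z_\ell)\big)$$ ($c$ is a real function; $\tilde\theta_t$ is arbitrary if there is no minimizer). It pulls $I_t\in\arg\max_{i}x_i^\top\tilde\theta_t$, with any tie-breaking that does not anticipate the rewards of the round. **Theorem.** Assume that every $x_i$ has at most one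 non-zero entry. Let $$c_1=\sigma\dot\mu_{\min}^{-1}\sqrt{d\log(n/d)+2\log n},\qquad c_2=c_1\dot\mu_{\min}^{-1}\dot\mu_{\max}\sqrt{2\log(Kn)},\qquad a=c_1\dot\mu_{\max},$$ and let the number $\tau$ of initial exploration rounds be such that, almost surely, $$\lambda_{\min}(G_\tau)\ge\max\{4\sigma^2\dot\mu_{\min}^{-2}(d\log(n/d)+2\log n),\ 8a^2\dot\mu_{\min}^{-2}\log n,\ 1\}.$$ Then the $n$-round regret of GLM-FPL satisfies $$R(n)\le\dot\mu_{\max}(c_1+c_2)\Big(1+\frac{2}{0.15-1/n}\Big)\sqrt{2dn\log(2n/d)}+(4+\tau)\Delta_{\max}.$$ In particular, up to the cost $(4+\tau)\Delta_{\max}$, the regret is $\tilde O(d\sqrt{n\log K})$: there is a constant $M$ that depends only on $\sigma$, $\dot\mu_{\min}$ and $\dot\mu_{\max}$ such that $$R(n)\le M\,d\sqrt{n\log K}\,(\log n)^{3/2}+(4+\tau)\Delta_{\max}.$$ -/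

import Mathlib

open MeasureTheory ProbabilityTheory
open scoped RealInnerProductSpace

noncomputable section

/-- A stochastic generalized linear bandit with `K` arms and `d` features.

The mean function is `μ = b'`. The real functions `b` and `c` define the negative log likelihood
that the agent minimizes. The reward law of an arm is only required to have the mean that the GLM
prescribes and sub-Gaussian noise; its exponential-family form is not required. -/
structure GLMBandit (d K : ℕ) where
  /-- the function `b` with `b' = μ` -/
  b : ℝ → ℝ
  /-- the part of the log likelihood that does not depend on the parameters -/
  c : ℝ → ℝ
  /-- the feature vectors of the arms -/
  x : Fin K → EuclideanSpace ℝ (Fin d)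
  /-- the unknown parameter vector -/
  θstar : EuclideanSpace ℝ (Fin d)
  /-- the reward distributions of the arms -/
  ν : Fin K → Measure ℝ
  /-- the sub-Gaussian parameter of the noise -/
  σ : ℝ
  /-- the optimal arm -/
  best : Fin K
  contDiff_b : ContDiff ℝ 2 b
  deriv_mean_pos : ∀ z, 0 < deriv (deriv b) z
  norm_x_le : ∀ i, ‖x i‖ ≤ 1
  isProb : ∀ i, IsProbabilityMeasure (ν i)
  mean_reward : ∀ i, ∫ y, y ∂(ν i) = deriv b ⟪x i, θstar⟫
  σ_pos : 0 < σ
  subgaussian : ∀ i,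
    HasSubgaussianMGF (fun y => y - deriv b ⟪x i, θstar⟫) (σ ^ 2).toNNReal (ν i)
  best_unique : ∀ i, i ≠ best → deriv b ⟪x i, θstar⟫ < deriv b ⟪x best, θstar⟫

/-- The negative log likelihood `∑ b(xᵀθ) - y xᵀθ - c(y)` of observations `(X ℓ, y ℓ)`, `ℓ ∈ s`. -/
def negLogLik {d : ℕ} (b c : ℝ → ℝ) (s : Finset ℕ) (X : ℕ → EuclideanSpace ℝ (Fin d))
    (y : ℕ → ℝ) (θ : EuclideanSpace ℝ (Fin d)) : ℝ :=
  ∑ ℓ ∈ s, (b ⟪X ℓ, θ⟫ - y ℓ * ⟪X ℓ, θ⟫ - c (y ℓ))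

/-- The minimum eigenvalue of a real (symmetric) matrix. -/
def lambdaMin {d : ℕ} (M : Matrix (Fin d) (Fin d) ℝ) : ℝ :=
  sInf {r : ℝ | Module.End.HasEigenvalue (Matrix.toLin' M) r}

namespace GLMBandit

variable {d K : ℕ} (B : GLMBandit d K)

/-- The mean function. -/
def mean (z : ℝ) : ℝ := deriv B.b z

/-- The gap of an arm. -/
def gap (i : Fin K) : ℝ := B.mean ⟪B.x B.best, B.θstar⟫ - B.mean ⟪B.x i, B.θstar⟫

/-- The maximum gap. -/
def gapMax : ℝ := ⨆ i, B.gap i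

/-- The minimum derivative of the mean function in the unit ball centered at `θstar`. -/
def slopeMin : ℝ :=
  sInf {r : ℝ | ∃ x θ : EuclideanSpace ℝ (Fin d),
    ‖x‖ ≤ 1 ∧ ‖θ - B.θstar‖ ≤ 1 ∧ r = deriv B.mean ⟪x, θ⟫}

/-- The values of the derivative of the mean function at `xᵀθ` with `‖x‖ ≤ 1` and any `θ`. -/
def slopes : Set ℝ :=
  {r : ℝ | ∃ x θ : EuclideanSpace ℝ (Fin d), ‖x‖ ≤ 1 ∧ r = deriv B.mean ⟪x, θ⟫}

/-- The maximum derivative of the mean function. -/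
def slopeMax : ℝ := sSup B.slopes

/-- The unweighted Hessian `G_t = ∑_{ℓ = 1}^{t - 1} X_ℓ X_ℓᵀ` for a sequence of pulled arms. -/
def gram (arm : ℕ → Fin K) (t : ℕ) : Matrix (Fin d) (Fin d) ℝ :=
  ∑ ℓ ∈ Finset.Ico 1 t, Matrix.vecMulVec (fun j => B.x (arm ℓ) j) (fun j => B.x (arm ℓ) j)

variable {Ω : Type*}

/-- The pulled arms and observed rewards in rounds `1, …, t - 1`, where `Y i ℓ` is the reward of
arm `i` in round `ℓ` and `I ℓ` is the arm pulled in round `ℓ`. -/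
def history (Y : Fin K → ℕ → Ω → ℝ) (I : ℕ → Ω → Fin K) (t : ℕ) (ω : Ω) :
    Finset.Ico 1 t → Fin K × ℝ :=
  fun ℓ => (I ℓ ω, Y (I ℓ ω) ℓ ω)

/-- The expected `n`-round regret. -/
def regret [MeasurableSpace Ω] (P : Measure Ω) (I : ℕ → Ω → Fin K) (n : ℕ) : ℝ :=
  ∑ i ∈ Finset.univ.erase B.best,
    B.gap i * ∫ ω, ∑ t ∈ Finset.Icc 1 n, (if I t ω = i then (1 : ℝ) else 0) ∂P

/-- `Y`, `Z`, `θ'`, `I` are the rewards, perturbations, perturbed estimates and pulled arms of a run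
of GLM-FPL for `n` rounds, with `τ` initial exploration rounds and perturbation scale `a`.

In an exploration round the arm is any choice that does not anticipate the rewards of the round. In
a later round, `θ' t` is a maximum likelihood estimate for the perturbed history whenever there is
one (it is arbitrary if the perturbed negative log likelihood has no minimizer), and the pulled arm
maximizes the estimated reward, with any tie-breaking that does not anticipate the rewards of
the round. -/
structure IsGLMFPL [MeasurableSpace Ω] (P : Measure Ω) (n τ : ℕ) (a : ℝ)
    (Y : Fin K → ℕ → Ω → ℝ) (Z : ℕ → ℕ → Ω → ℝ)
    (θ' : ℕ → Ω → EuclideanSpace ℝ (Fin d)) (I : ℕ → Ω → Fin K) : Prop where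
  measurable_Y : ∀ i, ∀ t ∈ Finset.Icc 1 n, Measurable (Y i t)
  measurable_I : ∀ t ∈ Finset.Icc 1 n, Measurable (I t)
  measurable_Z : ∀ t ∈ Finset.Ioc τ n, ∀ ℓ ∈ Finset.Ico 1 t, Measurable (Z t ℓ)
  /-- the rewards of arm `i` have law `ν i` -/
  law_Y : ∀ i, ∀ t ∈ Finset.Icc 1 n, P.map (Y i t) = B.ν i
  /-- the rewards of a round are drawn independently of the history and of the pulled arm -/
  indep_Y : ∀ t ∈ Finset.Icc 1 n,
    IndepFun (fun ω i => Y i t ω) (fun ω => (history Y I t ω, I t ω)) P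
  /-- the perturbations of round `t` are normal with mean `0` and variance `a ^ 2` -/
  law_Z : ∀ t ∈ Finset.Ioc τ n, ∀ ℓ ∈ Finset.Ico 1 t,
    P.map (Z t ℓ) = gaussianReal 0 (a ^ 2).toNNReal
  /-- the perturbations of round `t` are independent of each other -/
  iIndep_Z : ∀ t ∈ Finset.Ioc τ n, iIndepFun (fun (ℓ : Finset.Ico 1 t) => Z t ℓ) P
  /-- the perturbations of round `t` are independent of the history -/
  indep_Z : ∀ t ∈ Finset.Ioc τ n,
    IndepFun (fun ω (ℓ : Finset.Ico 1 t) => Z t ℓ ω) (history Y I t) P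
  /-- the maximum likelihood estimate on the perturbed history -/
  estimate : ∀ t ∈ Finset.Ioc τ n, ∀ᵐ ω ∂P,
    let L := negLogLik B.b B.c (Finset.Ico 1 t) (fun ℓ => B.x (I ℓ ω))
      (fun ℓ => Y (I ℓ ω) ℓ ω + Z t ℓ ω)
    (∃ θ, IsMinOn L Set.univ θ) → IsMinOn L Set.univ (θ' t ω)
  /-- the arm with the highest estimated reward is pulled -/
  greedy : ∀ t ∈ Finset.Ioc τ n, ∀ᵐ ω ∂P, ∀ i, ⟪B.x i, θ' t ω⟫ ≤ ⟪B.x (I t ω), θ' t ω⟫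

end GLMBandit

end

/-! Sparsity makes the Gram matrix diagonal, so the likelihood splits into `d` one-dimensional
problems. Each is governed by the information g_j, the j-th diagonal entry. At `θstar` the j-th
score of the perturbed data is N_j + W_j: the accumulated reward noise plus a term that, given the
history, is N(0, a² g_j). Within distance one of θstar_j the partial derivative of the loss grows at
rate at least slopeMin · g_j. Hence |N_j + W_j| ≤ slopeMin · C · √g_j, with C = `radius`, forces an
estimation error of at most C / √g_j whose direction is the sign of the score
(`OneSparse.estimate_close`). The eigenvalue condition gives C ≤ √g_j, so the estimate stays in the
region where this rate is valid.

The reward noise is handled by the method of mixtures (`lintegral_mixture_le`): a Gaussian mixture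
M_j of exponential supermartingales has mean at most one. It enters as a random weight: given the
history, coordinate j is bad with probability at most (1 + 2 M_j / (n - d + 1)) / (dn)
(`gaussianReal_bad_le`). The union over coordinates then costs only 1/n plus a lower-order term per
round. A separate noise bound, 2 / (n - d + 1), is needed only for the coordinate of the best arm.
Over all greedy rounds these failures cost at most 4 maximal gaps.

Exploration comes from anti-concentration. With probability at least 0.15 the perturbation exceeds
one standard deviation in the favourable direction. Since a dominates the noise width, this
outweighs the noise of the best arm, which is then overestimated. The greedy arm is then unresolved
(gap at most C times its width), so its width is at least the smallest width u of an unresolved arm.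
Testing this against u restricted to the small-noise event gives 0.15 E u ≤ E width + E u / n + ε.
Conversely, comparison with the least uncertain unresolved arm bounds the linear gap of the greedy
arm by C (2u + width). `integral_gap_le` combines both, and `OneSparse.sum_width_le` sums the widths
by the elliptical potential. -/

section GaussianTail

/-! ### Tails and anti-concentration of the standard Gaussian -/

open Set

lemma gaussianReal_Ioi_eq_Iio_neg (x : ℝ) :
    gaussianReal 0 1 (Ioi x) = gaussianReal 0 1 (Iio (-x)) := by
  have h := gaussianReal_map_neg (μ := 0) (v := 1)
  rw [neg_zero] at h
  conv_lhs => rw [← h]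
  rw [Measure.map_apply measurable_neg measurableSet_Ioi]
  congr 1
  ext y
  simp only [mem_preimage, mem_Ioi, mem_Iio]
  constructor <;> intro h <;> linarith

lemma gaussianReal_Ioi_zero : gaussianReal 0 1 (Ioi (0 : ℝ)) = 2⁻¹ := by
  have := nullSingletonClass_gaussianReal (μ := 0) (v := 1) one_ne_zero
  have h1 : gaussianReal 0 1 (Iic (0 : ℝ)) = gaussianReal 0 1 (Ioi (0 : ℝ)) := by
    rw [gaussianReal_Ioi_eq_Iio_neg, neg_zero]
    exact (measure_congr Iio_ae_eq_Iic).symm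
  have h2 : gaussianReal 0 1 (Ioi (0 : ℝ)) + gaussianReal 0 1 (Ioi (0 : ℝ)) = 1 := by
    nth_rewrite 1 [← h1]
    rw [← compl_Iic, measure_add_measure_compl measurableSet_Iic, measure_univ]
  rw [← two_mul] at h2
  exact ENNReal.eq_inv_of_mul_eq_one_left (by rw [mul_comm]; exact h2)

/-- Translation by x: for u > 0 the density at u + x is at most exp(-x²/2) times the density at u.
The factor one half makes the two-sided tail bound free of a factor 2. -/
lemma gaussianReal_Ioi_le {x : ℝ} (hx : 0 ≤ x) :
    gaussianReal 0 1 (Ioi x) ≤ ENNReal.ofReal (Real.exp (-(x ^ 2) / 2)) * 2⁻¹ := by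
  rw [← gaussianReal_Ioi_zero, gaussianReal_apply _ one_ne_zero, gaussianReal_apply _ one_ne_zero,
    ← lintegral_indicator measurableSet_Ioi, ← lintegral_indicator measurableSet_Ioi,
    ← lintegral_add_right_eq_self _ x,
    ← lintegral_const_mul _ ((measurable_gaussianPDF _ _).indicator measurableSet_Ioi)]
  refine lintegral_mono fun u => ?_
  by_cases hu : 0 < u
  · rw [indicator_of_mem (by simpa using hu), indicator_of_mem (by simpa using hu),
      gaussianPDF_def]
    beta_reduce
    rw [← ENNReal.ofReal_mul (Real.exp_nonneg _)]
    refine ENNReal.ofReal_le_ofReal ?_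
    rw [gaussianPDFReal_def]
    simp only [NNReal.coe_one, mul_one, sub_zero]
    rw [mul_left_comm, ← Real.exp_add]
    gcongr
    nlinarith [mul_nonneg hu.le hx]
  · rw [indicator_of_notMem (by simpa using hu)]
    exact zero_le

/-- The exponent is the tangent of -q²/2 at q = s. Being linear in q and valid for negative q, it
tolerates a threshold that depends on the noise. -/
lemma gaussianReal_abs_gt_le (q : ℝ) {s : ℝ} (hs : 0 ≤ s) :
    gaussianReal 0 1 {z | q < |z|} ≤ ENNReal.ofReal (Real.exp (-(s * q) + s ^ 2 / 2)) := by
  rcases lt_or_ge q 0 with hq | hq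
  · refine (prob_le_one).trans ?_
    rw [← ENNReal.ofReal_one]
    refine ENNReal.ofReal_le_ofReal (Real.one_le_exp ?_)
    nlinarith [sq_nonneg s]
  · have h : {z : ℝ | q < |z|} ⊆ Ioi q ∪ Iio (-q) := by
      intro z hz
      rcases lt_abs.1 (show q < |z| from hz) with h | h
      · exact Or.inl h
      · exact Or.inr (by simp only [mem_Iio]; linarith)
    refine (measure_mono h).trans ((measure_union_le _ _).trans ?_)
    rw [← gaussianReal_Ioi_eq_Iio_neg]
    refine (add_le_add (gaussianReal_Ioi_le hq) (gaussianReal_Ioi_le hq)).trans ?_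
    rw [← mul_add, ENNReal.inv_two_add_inv_two, mul_one]
    refine ENNReal.ofReal_le_ofReal (Real.exp_le_exp.2 ?_)
    nlinarith [sq_nonneg (q - s)]

/-- The product (1 - y + y²/2)(1 + y + y²/2) equals 1 + y⁴/4 ≥ 1, so the quadratic lower bound for
exp y suffices. -/
lemma exp_neg_le_quadratic {y : ℝ} (hy : 0 ≤ y) : Real.exp (-y) ≤ 1 - y + y ^ 2 / 2 := by
  rw [Real.exp_neg]
  refine inv_le_of_inv_le₀ (by nlinarith [sq_nonneg (y - 1)]) ?_
  refine le_trans ?_ (Real.quadratic_le_exp_of_nonneg hy)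
  refine inv_le_of_inv_le₀ (by positivity) ?_
  rw [inv_eq_one_div, div_le_iff₀ (by positivity)]
  nlinarith [sq_nonneg (y ^ 2)]

/-- The polynomial bound for the exponential integrates to 103/120, and dividing by √(2π) leaves
less than 0.35. Subtracting from the half-line mass 1/2 yields the constant 0.15 of the regret
bound. -/
lemma gaussianReal_Ioc_zero_one_le :
    gaussianReal 0 1 (Ioc (0 : ℝ) 1) ≤ ENNReal.ofReal 0.35 := by
  rw [gaussianReal_apply_eq_integral _ one_ne_zero]
  refine ENNReal.ofReal_le_ofReal ?_
  rw [← intervalIntegral.integral_of_le zero_le_one]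
  have h : ∫ x in (0 : ℝ)..1, gaussianPDFReal 0 1 x ≤
      ∫ x in (0 : ℝ)..1, (√(2 * Real.pi))⁻¹ * (1 - x ^ 2 / 2 + x ^ 4 / 8) := by
    refine intervalIntegral.integral_mono_on zero_le_one
      (integrable_gaussianPDFReal _ _).intervalIntegrable
      (Continuous.intervalIntegrable (by fun_prop) _ _) fun x _ => ?_
    rw [gaussianPDFReal_def]
    simp only [NNReal.coe_one, mul_one, sub_zero]
    gcongr
    have := exp_neg_le_quadratic (y := x ^ 2 / 2) (by positivity)
    rw [neg_div]
    linarith [this, show (x ^ 2 / 2) ^ 2 / 2 = x ^ 4 / 8 by ring]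
  refine h.trans ?_
  have h2 : ∫ x in (0 : ℝ)..1, (1 - x ^ 2 / 2 + x ^ 4 / 8) = 103 / 120 := by
    rw [intervalIntegral.integral_add (Continuous.intervalIntegrable (by fun_prop) _ _)
      (Continuous.intervalIntegrable (by fun_prop) _ _),
      intervalIntegral.integral_sub (Continuous.intervalIntegrable (by fun_prop) _ _)
      (Continuous.intervalIntegrable (by fun_prop) _ _)]
    simp
    norm_num
  rw [intervalIntegral.integral_const_mul, h2, inv_mul_le_iff₀ (by positivity)]
  have : (103 / 120 / 0.35 : ℝ) ≤ √(2 * Real.pi) := by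
    refine Real.le_sqrt_of_sq_le ?_
    have := Real.pi_gt_d2
    norm_num at this ⊢
    linarith
  norm_num at this ⊢
  linarith

lemma gaussianReal_Ici_one_ge : ENNReal.ofReal 0.15 ≤ gaussianReal 0 1 (Ici (1 : ℝ)) := by
  have h : gaussianReal 0 1 (Ioi (0 : ℝ)) ≤
      gaussianReal 0 1 (Ioc (0 : ℝ) 1) + gaussianReal 0 1 (Ici (1 : ℝ)) := by
    refine (measure_mono fun x hx => ?_).trans (measure_union_le _ _)
    rcases le_total x 1 with h | h
    · exact Or.inl ⟨hx, h⟩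
    · exact Or.inr h
  rw [gaussianReal_Ioi_zero] at h
  have h2 := h.trans (add_le_add_left gaussianReal_Ioc_zero_one_le _)
  have h3 : (2⁻¹ : ENNReal) = ENNReal.ofReal 0.35 + ENNReal.ofReal 0.15 := by
    rw [← ENNReal.ofReal_add (by norm_num) (by norm_num), show (0.35 + 0.15 : ℝ) = 2⁻¹ by norm_num,
      ENNReal.ofReal_inv_of_pos two_pos]
    simp
  rw [h3] at h2
  exact (ENNReal.add_le_add_iff_left ENNReal.ofReal_ne_top).1 h2

lemma gaussianReal_Iic_neg_one_ge : ENNReal.ofReal 0.15 ≤ gaussianReal 0 1 (Iic (-1 : ℝ)) := by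
  have h := gaussianReal_map_neg (μ := 0) (v := 1)
  rw [neg_zero] at h
  rw [← h, Measure.map_apply measurable_neg measurableSet_Iic]
  refine gaussianReal_Ici_one_ge.trans (measure_mono fun x hx => ?_)
  simp only [mem_preimage, mem_Iic, mem_Ici] at *
  linarith

end GaussianTail

/-! ### The inequality that balances the mixture penalty -/

section RealInequalities

lemma log_seven_gt : 1.94 < Real.log 7 := by
  have h : Real.log ((2 : ℝ) ^ 14) ≤ Real.log ((7 : ℝ) ^ 5) :=
    Real.log_le_log (by norm_num) (by norm_num)
  rw [Real.log_pow, Real.log_pow] at h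
  have := Real.log_two_gt_d9
  norm_num at h this ⊢
  linarith

/-- With w = 2g + 1 this is the logarithmic form of the penalty bound below in its tightest case m =
g. For w ≤ 4 the left side is nonpositive; beyond, the tangent of log at 8 is accurate enough. -/
lemma mul_log_div_four_le {w : ℝ} (hw : 3 ≤ w) :
    w * Real.log (w / 4) ≤ (w - 3) * Real.log ((w + 1) / 2) := by
  have h1 : 0 ≤ Real.log ((w + 1) / 2) := Real.log_nonneg (by linarith)
  rcases le_total w 4 with h | h
  · have : Real.log (w / 4) ≤ 0 := Real.log_nonpos (by positivity) (by linarith)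
    nlinarith
  · have h2 : Real.log (w / 4) + Real.log 2 ≤ Real.log ((w + 1) / 2) := by
      rw [← Real.log_mul (by positivity) (by norm_num)]
      exact Real.log_le_log (by positivity) (by linarith)
    have h3 : Real.log (w / 4) ≤ w / 8 - 1 + Real.log 2 := by
      have := Real.log_le_sub_one_of_pos (x := w / 8) (by positivity)
      have e : w / 4 = w / 8 * 2 := by ring
      rw [e, Real.log_mul (by positivity) (by norm_num)]
      linarith
    have l1 := Real.log_two_gt_d9
    have l2 := Real.log_two_lt_d9
    have h4 : (w - 3) * (Real.log (w / 4) + Real.log 2) ≤ (w - 3) * Real.log ((w + 1) / 2) :=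
      mul_le_mul_of_nonneg_left h2 (by linarith)
    nlinarith

/-- The mixture penalty `√(1 + 2g)` is compensated by the exponent. -/
lemma sqrt_mul_exp_neg_le {g m L : ℝ} (hg : 1 ≤ g) (hgm : g ≤ m)
    (hL : 3 * Real.log (m + 1) ≤ L) :
    √(1 + 2 * g) * Real.exp (-(L * (2 * g / (2 * g + 1)) / 2)) ≤ 2 / (m + 1) := by
  have hq : (0 : ℝ) < m + 1 := by linarith
  -- With L = 3 log(m + 1) and w = 2g + 1, the claim is w log(w/4) ≤ (w - 3) log(m + 1). Since w ≥
  -- 3, replacing g by m inside the last logarithm only helps.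
  have hw := mul_log_div_four_le (w := 2 * g + 1) (by linarith)
  have hlog : Real.log ((2 * g + 1 + 1) / 2) ≤ Real.log (m + 1) :=
    Real.log_le_log (by linarith) (by linarith)
  have hsplit : Real.log ((2 * g + 1) / 4) = Real.log (1 + 2 * g) - 2 * Real.log 2 := by
    rw [Real.log_div (by positivity) (by norm_num), show (4 : ℝ) = 2 ^ 2 by norm_num,
      Real.log_pow, add_comm (2 * g)]
    norm_num
  rw [← Real.log_le_log_iff (by positivity) (by positivity),
    Real.log_mul (by positivity) (by positivity), Real.log_exp, Real.log_sqrt (by positivity),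
    Real.log_div (by norm_num) (by positivity)]
  have h1 : (2 * g + 1) * Real.log ((2 * g + 1) / 4) ≤ (2 * g - 2) * Real.log (m + 1) := by
    refine hw.trans ?_
    rw [show 2 * g + 1 - 3 = 2 * g - 2 by ring]
    exact mul_le_mul_of_nonneg_left hlog (by linarith)
  rw [hsplit] at h1
  have h2 : L * (2 * g / (2 * g + 1)) / 2 ≥ 3 * Real.log (m + 1) * (2 * g / (2 * g + 1)) / 2 := by
    gcongr
  have h3 : Real.log (1 + 2 * g) - 2 * Real.log 2 ≤
      (2 * g - 2) * Real.log (m + 1) / (2 * g + 1) := by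
    rw [le_div_iff₀ (by positivity)]
    linarith
  have h4 : (2 * g - 2) * Real.log (m + 1) / (2 * g + 1) =
      3 * Real.log (m + 1) * (2 * g / (2 * g + 1)) - 2 * Real.log (m + 1) := by
    field_simp
    ring
  linarith

end RealInequalities

/-! ### Numerical consequences of the confidence width -/

section RealInequalities

/-- The squared confidence width `d log (n / d) + 2 log n`. -/
noncomputable def confWidth (d n : ℕ) : ℝ := d * Real.log (n / d) + 2 * Real.log n

/-- Bernoulli's inequality gives (n/d)^d ≥ n - d + 1. The number n - d matters because it bounds the
information of a coordinate. -/
lemma confWidth_ge {d n : ℕ} (hd : 1 ≤ d) (hdn : d < n) :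
    2 * Real.log n + Real.log (n - d + 1) ≤ confWidth d n := by
  have hd' : (0 : ℝ) < d := by exact_mod_cast hd
  have hdn' : (d : ℝ) < n := by exact_mod_cast hdn
  have hB := one_add_mul_le_pow (a := ((n : ℝ) - d) / d)
    (le_trans (by norm_num) (div_nonneg (by linarith) hd'.le)) d
  have e1 : 1 + (d : ℝ) * (((n : ℝ) - d) / d) = n - d + 1 := by field_simp; ring
  have e2 : 1 + ((n : ℝ) - d) / d = n / d := by field_simp; ring
  rw [e1, e2] at hB
  have h := Real.log_le_log (by linarith) hB
  rw [Real.log_pow] at h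
  unfold confWidth
  linarith

lemma three_mul_log_le_confWidth {d n : ℕ} (hd : 1 ≤ d) (hdn : d < n) :
    3 * Real.log (n - d + 1) ≤ confWidth d n := by
  have hd' : (1 : ℝ) ≤ d := by exact_mod_cast hd
  have hdn' : (d : ℝ) < n := by exact_mod_cast hdn
  have h := Real.log_le_log (x := (n : ℝ) - d + 1) (y := n) (by linarith) (by linarith)
  linarith [confWidth_ge hd hdn]

lemma log_seven_le {n : ℕ} (hn : 7 ≤ n) : 1.94 < Real.log n :=
  log_seven_gt.trans_le (Real.log_le_log (by norm_num) (by exact_mod_cast hn))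

lemma confWidth_pos {d n : ℕ} (hd : 1 ≤ d) (hdn : d < n) (hn : 7 ≤ n) : 0 < confWidth d n := by
  have hdn' : (d : ℝ) < n := by exact_mod_cast hdn
  have h := Real.log_nonneg (x := (n : ℝ) - d + 1) (by linarith)
  linarith [confWidth_ge hd hdn, log_seven_le hn]

lemma sqrt_two_log_mul_le {d n : ℕ} (hd : 1 ≤ d) (hdn : d < n) :
    √(2 * Real.log (d * n)) ≤ 2 * √(Real.log n) := by
  have hd' : (1 : ℝ) ≤ d := by exact_mod_cast hd
  have hdn' : (d : ℝ) < n := by exact_mod_cast hdn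
  have h1 : Real.log (d * n) ≤ 2 * Real.log n := by
    rw [Real.log_mul (by positivity) (by linarith)]
    linarith [Real.log_le_log (x := (d : ℝ)) (by linarith) hdn'.le]
  calc √(2 * Real.log (d * n)) ≤ √(2 ^ 2 * Real.log n) := Real.sqrt_le_sqrt (by linarith)
    _ = 2 * √(Real.log n) := by rw [Real.sqrt_mul (by norm_num), Real.sqrt_sq (by norm_num)]

lemma one_add_sqrt_two_log_mul_le {d n : ℕ} (hd : 1 ≤ d) (hdn : d < n) (hn : 7 ≤ n) :
    1 + √(2 * Real.log (d * n)) ≤ √(8 * Real.log n) := by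
  have hl := log_seven_le hn
  refine Real.le_sqrt_of_sq_le ?_
  have h := sqrt_two_log_mul_le hd hdn
  have h0 := Real.sqrt_nonneg (2 * Real.log (d * n))
  have hx := Real.sq_sqrt (show 0 ≤ Real.log n by linarith)
  set x := √(Real.log n)
  have hx0 : 1.39 ≤ x := Real.le_sqrt_of_sq_le (by norm_num at hl ⊢; linarith)
  nlinarith

/-- The factor 2/3 is the least value of 2g / (2g + 1) for g ≥ 1, so the tilt of the Gaussian tail
is dominated by the exponent of the mixture. -/
lemma sqrt_two_log_mul_le_confWidth {d n : ℕ} (hd : 1 ≤ d) (hdn : d + 2 ≤ n) (hn : 7 ≤ n) :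
    √(2 * Real.log (d * n)) ≤ 2 / 3 * confWidth d n := by
  have hl := log_seven_le hn
  have hdn' : (d : ℝ) + 2 ≤ n := by exact_mod_cast hdn
  refine (sqrt_two_log_mul_le hd (by omega)).trans ?_
  have h1 := confWidth_ge hd (show d < n by omega)
  have h2 : Real.log 2 ≤ Real.log ((n : ℝ) - d + 1) :=
    Real.log_le_log (by norm_num) (by linarith)
  have l2 := Real.log_two_gt_d9
  have hx := Real.sq_sqrt (show 0 ≤ Real.log n by linarith)
  set x := √(Real.log n)
  have hx0 : 1.39 ≤ x := Real.le_sqrt_of_sq_le (by norm_num at hl ⊢; linarith)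
  nlinarith

/-- The mixture process of a coordinate with information `g` and normalized noise `y`. -/
noncomputable def mixVal (L g y : ℝ) : ℝ :=
  Real.exp (L * (2 * g / (2 * g + 1)) * y ^ 2 / 2) / √(1 + 2 * g)

lemma mixVal_nonneg (L g y : ℝ) : 0 ≤ mixVal L g y := by unfold mixVal; positivity

lemma exp_le_mul_mixVal {g m L y : ℝ} (hg : 1 ≤ g) (hgm : g ≤ m)
    (hL : 3 * Real.log (m + 1) ≤ L) :
    Real.exp (L * (2 * g / (2 * g + 1)) * (y ^ 2 - 1) / 2) ≤ 2 / (m + 1) * mixVal L g y := by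
  have h := sqrt_mul_exp_neg_le hg hgm hL
  have h2 := mul_le_mul_of_nonneg_right h (mixVal_nonneg L g y)
  refine le_trans (le_of_eq ?_) h2
  have hs : √(1 + 2 * g) ≠ 0 := by positivity
  unfold mixVal
  rw [mul_comm (√(1 + 2 * g)), mul_assoc (Real.exp _), mul_div_cancel₀ _ hs, ← Real.exp_add]
  congr 1
  ring

lemma one_le_mul_mixVal {g m L y : ℝ} (hg : 1 ≤ g) (hgm : g ≤ m)
    (hL : 3 * Real.log (m + 1) ≤ L) (hy : 1 ≤ y ^ 2) :
    1 ≤ 2 / (m + 1) * mixVal L g y := by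
  refine le_trans (Real.one_le_exp ?_) (exp_le_mul_mixVal hg hgm hL)
  have : 0 ≤ L := le_trans (mul_nonneg (by norm_num) (Real.log_nonneg (by linarith))) hL
  have : 0 ≤ y ^ 2 - 1 := by linarith
  positivity

/-- The conditional probability that the perturbed noise leaves the confidence interval. -/
lemma exp_tail_le {g m L y s κ : ℝ} (hg : 1 ≤ g) (hgm : g ≤ m)
    (hL : 3 * Real.log (m + 1) ≤ L) (hs : 0 ≤ s) (hsL : s ≤ 2 / 3 * L)
    (hκ : 1 ≤ κ) :
    Real.exp (-(s * (s + (1 - y) / κ)) + s ^ 2 / 2) ≤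
      Real.exp (-(s ^ 2) / 2) * (1 + 2 / (m + 1) * mixVal L g y) := by
  have hm : 0 < m + 1 := by linarith
  have hM := mixVal_nonneg L g y
  have hL0 : 0 ≤ L := le_trans (mul_nonneg (by norm_num) (Real.log_nonneg (by linarith))) hL
  rw [show -(s * (s + (1 - y) / κ)) + s ^ 2 / 2 = -(s ^ 2) / 2 + s * ((y - 1) / κ) by ring,
    Real.exp_add]
  refine mul_le_mul_of_nonneg_left ?_ (Real.exp_nonneg _)
  -- Noise inside its confidence width only lowers the tail, which the summand 1 covers; excess
  -- noise is paid for by the mixture.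
  rcases le_total y 1 with hy | hy
  · have : Real.exp (s * ((y - 1) / κ)) ≤ 1 := by
      rw [Real.exp_le_one_iff]
      exact mul_nonpos_of_nonneg_of_nonpos hs (div_nonpos_of_nonpos_of_nonneg (by linarith)
        (by linarith))
    have : 0 ≤ 2 / (m + 1) * mixVal L g y := by positivity
    linarith
  · refine le_trans ?_ ((exp_le_mul_mixVal hg hgm hL).trans (le_add_of_nonneg_left zero_le_one))
    refine Real.exp_le_exp.2 ?_
    have h1 : (y - 1) / κ ≤ y - 1 := div_le_self (by linarith) hκ
    have h2 : 2 / 3 * L ≤ L * (2 * g / (2 * g + 1)) := by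
      rw [mul_comm]
      refine mul_le_mul_of_nonneg_left ?_ hL0
      rw [le_div_iff₀ (by positivity)]
      linarith
    set L' := L * (2 * g / (2 * g + 1))
    have h3 : s * ((y - 1) / κ) ≤ s * (y - 1) := mul_le_mul_of_nonneg_left h1 hs
    -- Uses (y² - 1)/2 = (y - 1) + (y - 1)²/2.
    nlinarith [mul_nonneg (show 0 ≤ L' - s by linarith) (show 0 ≤ y - 1 by linarith),
      mul_nonneg (show 0 ≤ L' by linarith) (sq_nonneg (y - 1))]

/-- Absorbs the accumulated failure term 2/n. Doubling the argument of the logarithm adds 2dn log 2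
> 9 under the root, while squaring the left side adds at most 8 + 1. -/
lemma sqrt_add_two_div_le {d n : ℕ} (hd : 1 ≤ d) (hdn : d < n) (hn : 7 ≤ n) :
    √(2 * d * n * Real.log (n / d)) + 2 / n ≤ √(2 * d * n * Real.log (2 * n / d)) := by
  have hd' : (1 : ℝ) ≤ d := by exact_mod_cast hd
  have hn' : (7 : ℝ) ≤ n := by exact_mod_cast hn
  have hdn' : (d : ℝ) < n := by exact_mod_cast hdn
  have h1 : Real.log (2 * n / d) = Real.log 2 + Real.log (n / d) := by
    rw [mul_div_assoc, Real.log_mul (by norm_num) (by positivity)]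
  have h0 : 0 ≤ Real.log ((n : ℝ) / d) :=
    Real.log_nonneg ((one_le_div (by linarith)).2 hdn'.le)
  have h2 : (d : ℝ) * Real.log (n / d) ≤ n := by
    have := Real.log_le_sub_one_of_pos (x := (n : ℝ) / d) (by positivity)
    have h3 := mul_le_mul_of_nonneg_left this (show (0 : ℝ) ≤ d by linarith)
    rw [mul_sub, mul_div_cancel₀ _ (by positivity)] at h3
    linarith
  refine Real.le_sqrt_of_sq_le ?_
  have hA : 0 ≤ 2 * d * n * Real.log ((n : ℝ) / d) := by positivity
  have hs := Real.sq_sqrt hA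
  have hs2 : √(2 * d * n * Real.log ((n : ℝ) / d)) ≤ 2 * n := by
    refine Real.sqrt_le_iff.2 ⟨by positivity, ?_⟩
    nlinarith
  have l2 := Real.log_two_gt_d9
  rw [h1]
  set A := √(2 * d * n * Real.log ((n : ℝ) / d))
  have h4 : 2 * A * (2 / n) ≤ 8 := by
    rw [mul_div_assoc', div_le_iff₀ (by positivity)]
    linarith
  have h5 : (2 / (n : ℝ)) ^ 2 ≤ 1 := by
    have : 2 / (n : ℝ) ≤ 1 := by rw [div_le_one (by positivity)]; linarith
    have h6 : 0 ≤ 2 / (n : ℝ) := by positivity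
    nlinarith
  have h6 : 7 ≤ (d : ℝ) * n := by nlinarith
  nlinarith [mul_le_mul h6 l2.le (by norm_num) (by positivity)]

/-- Here k counts the greedy rounds. Exploration takes at least d + 1 rounds, so k / (n - d + 1) ≤
1, and the three failure terms contribute at most 2, 1 and 1. -/
lemma failure_sum_le {d n k : ℕ} (hkd : k + d + 1 ≤ n) (hn : 7 ≤ n) :
    (k : ℝ) * (2 / ((n : ℝ) - d + 1) + (1 / n + 2 / (((n : ℝ) - d + 1) * n))) ≤ 4 ∧
      (k : ℝ) * (2 / (((n : ℝ) - d + 1) * n)) ≤ 2 / n := by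
  have hn' : (7 : ℝ) ≤ n := by exact_mod_cast hn
  have hk : (k : ℝ) + d + 1 ≤ n := by exact_mod_cast hkd
  have hd : (0 : ℝ) ≤ d := Nat.cast_nonneg _
  have hk0 : (0 : ℝ) ≤ k := Nat.cast_nonneg _
  have hq : (0 : ℝ) < (n : ℝ) - d + 1 := by linarith
  have e1 : (k : ℝ) * (2 / ((n : ℝ) - d + 1)) ≤ 2 := by
    rw [mul_div_assoc', div_le_iff₀ hq]; linarith
  have e2 : (k : ℝ) * (1 / n) ≤ 1 := by
    rw [mul_div_assoc', div_le_iff₀ (by linarith)]; linarith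
  have e3 : (k : ℝ) * (2 / (((n : ℝ) - d + 1) * n)) ≤ 2 / n := by
    rw [← div_div, mul_div_assoc']
    gcongr
  have e4 : 2 / (n : ℝ) ≤ 1 := by rw [div_le_one (by linarith)]; linarith
  refine ⟨?_, e3⟩
  rw [mul_add, mul_add]
  linarith

lemma regret_rate_le {d n K : ℕ} {σ lo hi c₁ c₂ : ℝ} (hd : 1 ≤ d) (hdn : d < n) (hn : 7 ≤ n)
    (hK : 2 ≤ K) (hσ : 0 < σ) (hlo : 0 < lo) (hhi : 0 < hi)
    (hc₁ : c₁ = σ * lo⁻¹ * √(d * Real.log (n / d) + 2 * Real.log n))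
    (hc₂ : c₂ = c₁ * lo⁻¹ * hi * √(2 * Real.log (K * n))) :
    hi * (c₁ + c₂) * (1 + 2 / (0.15 - 1 / n)) * √(2 * d * n * Real.log (2 * n / d)) ≤
      1124 * hi * (σ * lo⁻¹) * (1 + 3 * (lo⁻¹ * hi)) * (d * √(n * Real.log K)) *
        Real.log n ^ (3 / 2 : ℝ) := by
  have hd' : (1 : ℝ) ≤ d := by exact_mod_cast hd
  have hn' : (7 : ℝ) ≤ n := by exact_mod_cast hn
  have hK' : (2 : ℝ) ≤ K := by exact_mod_cast hK
  have hdn' : (d : ℝ) < n := by exact_mod_cast hdn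
  have hl := log_seven_le hn
  have l2 := Real.log_two_gt_d9
  have l2' := Real.log_two_lt_d9
  have hlK : 0.69 < Real.log K := by
    have := Real.log_le_log two_pos hK'
    norm_num at l2 ⊢
    linarith
  set l := Real.log n with hldef
  set k := Real.log K with hkdef
  have hl0 : 0 < l := by linarith
  have hk0 : 0 < k := by linarith
  have b1 : √(d * Real.log (n / d) + 2 * l) ≤ √(3 * (d * l)) := by
    refine Real.sqrt_le_sqrt ?_
    have : Real.log ((n : ℝ) / d) ≤ l :=
      Real.log_le_log (by positivity) (div_le_self (by linarith) hd')
    nlinarith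
  have hkl : 1 ≤ k * l := by nlinarith
  have b2 : √(2 * Real.log (K * n)) ≤ 3 * √(k * l) := by
    rw [show 3 * √(k * l) = √(3 ^ 2 * (k * l)) by
      rw [Real.sqrt_mul (by norm_num) (k * l), Real.sqrt_sq (by norm_num)]]
    refine Real.sqrt_le_sqrt ?_
    rw [Real.log_mul (by positivity) (by positivity)]
    nlinarith
  have b3 : √(2 * d * n * Real.log (2 * n / d)) ≤ √(4 * (d * n * l)) := by
    refine Real.sqrt_le_sqrt ?_
    have h : Real.log (2 * n / d) ≤ 2 * l := by
      have h1 : Real.log (2 * n / d) ≤ Real.log (2 * n) :=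
        Real.log_le_log (by positivity) (div_le_self (by linarith) hd')
      rw [Real.log_mul two_ne_zero (by positivity)] at h1
      linarith
    have h0 : (0 : ℝ) ≤ d * n := by positivity
    nlinarith
  -- The worst case n = 7 gives 0.15 - 1/7 = 1/140; the final constant is 1124 = 4 · 281.
  have b4 : 1 + 2 / (0.15 - 1 / (n : ℝ)) ≤ 281 := by
    have h1 : 1 / (n : ℝ) ≤ 1 / 7 := by gcongr
    have h2 : (1 / 140 : ℝ) ≤ 0.15 - 1 / n := by norm_num at h1 ⊢; linarith
    have h3 : 2 / (0.15 - 1 / (n : ℝ)) ≤ 2 / (1 / 140) := by gcongr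
    norm_num at h3 ⊢
    linarith
  have b4' : 0 ≤ 1 + 2 / (0.15 - 1 / (n : ℝ)) := by
    have h1 : 1 / (n : ℝ) ≤ 1 / 7 := by gcongr
    have h2 : (0 : ℝ) ≤ 0.15 - 1 / n := by norm_num at h1 ⊢; linarith
    positivity
  have hr : (1 : ℝ) ≤ √(k * l) := Real.one_le_sqrt.2 hkl
  have b5 : c₁ + c₂ ≤ σ * lo⁻¹ * √(3 * (d * l)) * ((1 + 3 * (lo⁻¹ * hi)) * √(k * l)) := by
    have e : c₁ + c₂ = σ * lo⁻¹ * √(d * Real.log (n / d) + 2 * l) *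
        (1 + lo⁻¹ * hi * √(2 * Real.log (K * n))) := by
      rw [hc₂, hc₁]; ring
    rw [e]
    gcongr
    have : lo⁻¹ * hi * √(2 * Real.log (K * n)) ≤ lo⁻¹ * hi * (3 * √(k * l)) := by gcongr
    nlinarith
  have hc0 : 0 ≤ c₁ + c₂ := by
    have : 0 ≤ c₁ := by rw [hc₁]; positivity
    rw [hc₂]; positivity
  have b6 : √(3 * (d * l)) * √(k * l) * √(4 * (d * n * l)) ≤
      4 * (d * √(n * k)) * l ^ (3 / 2 : ℝ) := by
    have e3 : l ^ (3 / 2 : ℝ) = √(l ^ 3) := by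
      rw [Real.sqrt_eq_rpow, ← Real.rpow_natCast, ← Real.rpow_mul hl0.le]
      norm_num
    rw [e3, ← Real.sqrt_mul (by positivity), ← Real.sqrt_mul (by positivity)]
    have e4 : 4 * (d * √(n * k)) * √(l ^ 3) = √((4 * d) ^ 2 * (n * k * l ^ 3)) := by
      rw [Real.sqrt_mul (by positivity) (n * k * l ^ 3), Real.sqrt_sq (by positivity),
        Real.sqrt_mul (by positivity) (l ^ 3)]
      ring
    rw [e4]
    refine Real.sqrt_le_sqrt ?_
    have h0 : 0 ≤ (d : ℝ) ^ 2 * (n * k * l ^ 3) := by positivity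
    nlinarith
  calc hi * (c₁ + c₂) * (1 + 2 / (0.15 - 1 / n)) * √(2 * d * n * Real.log (2 * n / d))
      ≤ hi * (σ * lo⁻¹ * √(3 * (d * l)) * ((1 + 3 * (lo⁻¹ * hi)) * √(k * l))) * 281 *
        √(4 * (d * n * l)) := by gcongr
    _ = 281 * hi * (σ * lo⁻¹) * (1 + 3 * (lo⁻¹ * hi)) *
        (√(3 * (d * l)) * √(k * l) * √(4 * (d * n * l))) := by ring
    _ ≤ 281 * hi * (σ * lo⁻¹) * (1 + 3 * (lo⁻¹ * hi)) *
        (4 * (d * √(n * k)) * l ^ (3 / 2 : ℝ)) := by gcongr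
    _ = _ := by ring

end RealInequalities

/-! ### Slopes, diagonal Gram matrices and the elliptical potential -/

namespace GLMBandit

variable {d K : ℕ} (B : GLMBandit d K)

/-- Every feature vector has at most one non-zero entry. -/
def OneSparse : Prop := ∀ i j k, B.x i j ≠ 0 → B.x i k ≠ 0 → j = k

/-- The `j`-th diagonal entry of the Gram matrix. -/
def info (arm : ℕ → Fin K) (t : ℕ) (j : Fin d) : ℝ :=
  ∑ ℓ ∈ Finset.Ico 1 t, B.x (arm ℓ) j ^ 2

/-- The norm of a feature vector in the inverse of a diagonal Gram matrix. -/
noncomputable def width (arm : ℕ → Fin K) (t : ℕ) (i : Fin K) : ℝ :=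
  ∑ j, |B.x i j| / √(B.info arm t j)

/-- The inner product of the residuals with the `j`-th feature. -/
def score (arm : ℕ → Fin K) (r : ℕ → ℝ) (t : ℕ) (j : Fin d) : ℝ :=
  ∑ ℓ ∈ Finset.Ico 1 t, B.x (arm ℓ) j * r ℓ

section Slopes

lemma differentiable_mean : Differentiable ℝ B.mean := by
  have h := B.contDiff_b
  rw [show (2 : WithTop ℕ∞) = 1 + 1 by norm_num, contDiff_succ_iff_deriv] at h
  exact h.2.2.differentiable one_ne_zero

lemma continuous_deriv_mean : Continuous (deriv B.mean) := by
  have h := B.contDiff_b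
  rw [show (2 : WithTop ℕ∞) = 1 + 1 by norm_num, contDiff_succ_iff_deriv] at h
  exact h.2.2.continuous_deriv le_rfl

lemma deriv_mean_pos' (z : ℝ) : 0 < deriv B.mean z := B.deriv_mean_pos z

lemma strictMono_mean : StrictMono B.mean := strictMono_of_deriv_pos B.deriv_mean_pos

lemma hasDerivAt_b (z : ℝ) : HasDerivAt B.b (B.mean z) z :=
  (B.contDiff_b.differentiable two_ne_zero z).hasDerivAt

lemma b_tangent_le (x y : ℝ) : B.b x + B.mean x * (y - x) ≤ B.b y := by
  have hc : ConvexOn ℝ Set.univ B.b :=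
    MonotoneOn.convexOn_of_deriv convex_univ B.contDiff_b.continuous.continuousOn
      (B.contDiff_b.differentiable two_ne_zero).differentiableOn
      (B.strictMono_mean.monotone.monotoneOn _)
  rcases lt_trichotomy x y with h | h | h
  · have := hc.le_slope_of_hasDerivAt (Set.mem_univ x) (Set.mem_univ y) h (B.hasDerivAt_b x)
    rw [slope_def_field, le_div_iff₀ (by linarith)] at this
    linarith
  · simp [h]
  · have := hc.slope_le_of_hasDerivAt (Set.mem_univ y) (Set.mem_univ x) h (B.hasDerivAt_b x)
    rw [slope_def_field, div_le_iff₀ (by linarith)] at this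
    linarith

lemma slopeMin_le {x θ : EuclideanSpace ℝ (Fin d)} (hx : ‖x‖ ≤ 1) (hθ : ‖θ - B.θstar‖ ≤ 1) :
    B.slopeMin ≤ deriv B.mean ⟪x, θ⟫ := by
  refine csInf_le ⟨0, ?_⟩ ⟨x, θ, hx, hθ, rfl⟩
  rintro r ⟨x, θ, -, -, rfl⟩
  exact (B.deriv_mean_pos' _).le

lemma slopeMin_pos : 0 < B.slopeMin := by
  let f : EuclideanSpace ℝ (Fin d) × EuclideanSpace ℝ (Fin d) → ℝ :=
    fun p => deriv B.mean ⟪p.1, p.2⟫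
  have hf : Continuous f := B.continuous_deriv_mean.comp (by fun_prop)
  have hc : IsCompact (Metric.closedBall (0 : EuclideanSpace ℝ (Fin d)) 1 ×ˢ
      Metric.closedBall B.θstar 1) :=
    (isCompact_closedBall _ _).prod (isCompact_closedBall _ _)
  obtain ⟨p, -, hp⟩ := hc.exists_isMinOn ⟨(0, B.θstar), by simp⟩ hf.continuousOn
  refine (B.deriv_mean_pos' ⟪p.1, p.2⟫).trans_le (le_csInf ⟨_, 0, B.θstar, by simp, by simp, rfl⟩ ?_)
  rintro r ⟨x, θ, hx, hθ, rfl⟩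
  exact hp (show (x, θ) ∈ _ from ⟨by simpa using hx, by simpa [dist_eq_norm] using hθ⟩)

lemma le_slopeMax (hb : BddAbove B.slopes) {x : EuclideanSpace ℝ (Fin d)} (hx : ‖x‖ ≤ 1)
    (θ : EuclideanSpace ℝ (Fin d)) : deriv B.mean ⟪x, θ⟫ ≤ B.slopeMax :=
  le_csSup hb ⟨x, θ, hx, rfl⟩

lemma slopeMin_le_slopeMax (hb : BddAbove B.slopes) : B.slopeMin ≤ B.slopeMax :=
  (B.slopeMin_le (x := 0) (θ := B.θstar) (by simp) (by simp)).trans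
    (B.le_slopeMax hb (by simp) _)

lemma slopeMax_pos (hb : BddAbove B.slopes) : 0 < B.slopeMax :=
  B.slopeMin_pos.trans_le (B.slopeMin_le_slopeMax hb)

/-- The gap of an arm in the linear predictor. -/
noncomputable def linGap (i : Fin K) : ℝ := ⟪B.x B.best, B.θstar⟫ - ⟪B.x i, B.θstar⟫

lemma gap_best : B.gap B.best = 0 := by simp [gap]

lemma gap_nonneg (i : Fin K) : 0 ≤ B.gap i := by
  by_cases h : i = B.best
  · rw [h, gap_best]
  · exact sub_nonneg.2 (B.best_unique i h).le

lemma linGap_nonneg (i : Fin K) : 0 ≤ B.linGap i :=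
  sub_nonneg.2 (B.strictMono_mean.le_iff_le.1 (sub_nonneg.1 (B.gap_nonneg i)))

lemma linGap_best : B.linGap B.best = 0 := by simp [linGap]

lemma gap_le_gapMax (i : Fin K) : B.gap i ≤ B.gapMax :=
  le_ciSup (Set.finite_range B.gap).bddAbove i

lemma gapMax_nonneg : 0 ≤ B.gapMax := (B.gap_nonneg B.best).trans (B.gap_le_gapMax _)

/-- Mean value theorem. The intermediate point is the predictor of a convex combination of the two
feature vectors, which stays in the unit ball, so `slopeMax` bounds the derivative there. -/
lemma gap_le_slopeMax_mul (hb : BddAbove B.slopes) (i : Fin K) :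
    B.gap i ≤ B.slopeMax * B.linGap i := by
  rcases (B.linGap_nonneg i).eq_or_lt with h | h
  · have e : ⟪B.x B.best, B.θstar⟫ = ⟪B.x i, B.θstar⟫ := sub_eq_zero.1 h.symm
    simp [gap, e, ← h]
  · have hlt : ⟪B.x i, B.θstar⟫ < ⟪B.x B.best, B.θstar⟫ := sub_pos.1 h
    obtain ⟨z, hz, hz2⟩ := exists_deriv_eq_slope B.mean hlt
      B.differentiable_mean.continuous.continuousOn B.differentiable_mean.differentiableOn
    rw [eq_div_iff (sub_pos.2 hlt).ne'] at hz2
    have e : B.gap i = deriv B.mean z * B.linGap i := hz2.symm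
    rw [e]
    refine mul_le_mul_of_nonneg_right ?_ h.le
    set w := (z - ⟪B.x i, B.θstar⟫) / B.linGap i
    have hw0 : 0 ≤ w := div_nonneg (by linarith [hz.1]) h.le
    have hw1 : w ≤ 1 := by
      rw [div_le_one h]; unfold linGap; linarith [hz.2]
    have hzw : z = ⟪(1 - w) • B.x i + w • B.x B.best, B.θstar⟫ := by
      rw [inner_add_left, real_inner_smul_left, real_inner_smul_left]
      have : w * B.linGap i = z - ⟪B.x i, B.θstar⟫ := div_mul_cancel₀ _ h.ne'
      unfold linGap at this
      linarith
    rw [hzw]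
    refine B.le_slopeMax hb ?_ _
    have hconv := convex_closedBall (0 : EuclideanSpace ℝ (Fin d)) 1
    have := hconv (x := B.x i) (by simpa using B.norm_x_le i) (y := B.x B.best)
      (by simpa using B.norm_x_le B.best) (a := 1 - w) (b := w) (by linarith) hw0 (by ring)
    simpa using this

end Slopes

section Sparse

variable {B} (hs : B.OneSparse)
include hs

lemma OneSparse.inner_eq {i : Fin K} {j : Fin d} (h : B.x i j ≠ 0)
    (θ : EuclideanSpace ℝ (Fin d)) : ⟪B.x i, θ⟫ = B.x i j * θ j := by
  rw [PiLp.inner_apply, Finset.sum_eq_single j]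
  · simp [mul_comm]
  · intro k _ hk
    have : B.x i k = 0 := by
      by_contra h2
      exact hk (hs i j k h h2).symm
    simp [this]
  · simp

end Sparse

lemma sum_sq_le_one (i : Fin K) : ∑ j, B.x i j ^ 2 ≤ 1 := by
  have h := B.norm_x_le i
  rw [EuclideanSpace.norm_eq, Real.sqrt_le_one] at h
  simpa using h

lemma info_nonneg (arm : ℕ → Fin K) (t : ℕ) (j : Fin d) : 0 ≤ B.info arm t j :=
  Finset.sum_nonneg fun _ _ => sq_nonneg _

lemma info_mono (arm : ℕ → Fin K) {s t : ℕ} (h : s ≤ t) (j : Fin d) :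
    B.info arm s j ≤ B.info arm t j :=
  Finset.sum_le_sum_of_subset_of_nonneg (Finset.Ico_subset_Ico_right h) fun _ _ _ => sq_nonneg _

lemma sum_info_le (arm : ℕ → Fin K) {t : ℕ} (ht : 1 ≤ t) :
    ∑ j, B.info arm t j ≤ (t : ℝ) - 1 := by
  unfold info
  rw [Finset.sum_comm]
  refine (Finset.sum_le_sum fun ℓ _ => B.sum_sq_le_one (arm ℓ)).trans ?_
  simp [ht]

lemma dim_add_one_le (arm : ℕ → Fin K) {t : ℕ} (ht : 1 ≤ t)
    (h : ∀ j, 1 ≤ B.info arm t j) : d + 1 ≤ t := by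
  have h1 : ∑ _j : Fin d, (1 : ℝ) ≤ ∑ j, B.info arm t j := Finset.sum_le_sum fun j _ => h j
  have h2 := h1.trans (B.sum_info_le arm ht)
  simp only [Finset.sum_const, Finset.card_univ, Fintype.card_fin, nsmul_eq_mul, mul_one] at h2
  have : (d : ℝ) + 1 ≤ t := by linarith
  exact_mod_cast this

/-- The trace of the Gram matrix is at most n - 1, and the other d - 1 coordinates each hold at
least one unit of it. -/
lemma info_le_sub (arm : ℕ → Fin K) {t n : ℕ} (ht : 1 ≤ t) (htn : t ≤ n)
    (h : ∀ j, 1 ≤ B.info arm t j) (j : Fin d) : B.info arm t j ≤ (n : ℝ) - d := by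
  have h1 := B.sum_info_le arm ht
  rw [← Finset.add_sum_erase _ _ (Finset.mem_univ j)] at h1
  have h2 : ∑ _k ∈ Finset.univ.erase j, (1 : ℝ) ≤ ∑ k ∈ Finset.univ.erase j, B.info arm t k :=
    Finset.sum_le_sum fun j _ => h j
  have hd : 1 ≤ d := Nat.one_le_of_lt j.2
  simp only [Finset.sum_const, Finset.card_erase_of_mem (Finset.mem_univ j), Finset.card_univ,
    Fintype.card_fin, nsmul_eq_mul, mul_one, Nat.cast_sub hd, Nat.cast_one] at h2
  have : (t : ℝ) ≤ n := by exact_mod_cast htn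
  linarith

/-- An arm informs at most one coordinate, so choosing an informative arm for each coordinate is
injective. This lets log(Kn) replace log(dn) in the confidence radius. -/
lemma OneSparse.dim_le_card {B : GLMBandit d K} (hs : B.OneSparse) (arm : ℕ → Fin K) {t : ℕ}
    (h : ∀ j, 1 ≤ B.info arm t j) : d ≤ K := by
  have hex : ∀ j, ∃ i, B.x i j ≠ 0 := by
    intro j
    by_contra! hc
    have := h j
    simp only [info, hc] at this
    norm_num at this
  choose f hf using hex
  have hinj : Function.Injective f := fun j k hjk => hs (f j) j k (hf j) (hjk ▸ hf k)
  simpa using Fintype.card_le_of_injective f hinj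

lemma OneSparse.gram_eq_diagonal {B : GLMBandit d K} (hs : B.OneSparse) (arm : ℕ → Fin K)
    (t : ℕ) : B.gram arm t = Matrix.diagonal (B.info arm t) := by
  ext j k
  rw [gram, Matrix.sum_apply]
  by_cases hjk : j = k
  · subst hjk
    simp [Matrix.vecMulVec_apply, info, sq]
  · rw [Matrix.diagonal_apply_ne _ hjk]
    refine Finset.sum_eq_zero fun ℓ _ => ?_
    rw [Matrix.vecMulVec_apply]
    by_contra hc
    exact hjk (hs _ j k (left_ne_zero_of_mul hc) (right_ne_zero_of_mul hc))

lemma OneSparse.lambdaMin_gram_le {B : GLMBandit d K} (hs : B.OneSparse) (arm : ℕ → Fin K)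
    (t : ℕ) (j : Fin d) : lambdaMin (B.gram arm t) ≤ B.info arm t j := by
  refine csInf_le (Module.End.finite_hasEigenvalue _).bddBelow ?_
  refine Module.End.hasEigenvalue_of_hasEigenvector (x := Pi.single j 1) ⟨?_, by simp⟩
  rw [Module.End.mem_eigenspace_iff, Matrix.toLin'_apply, hs.gram_eq_diagonal]
  ext k
  rw [Matrix.mulVec_diagonal]
  by_cases h : k = j
  · subst h; simp
  · simp [h]

section Width

variable {B} (hs : B.OneSparse)
include hs

/-- At most one summand is nonzero, so squaring produces no cross terms. -/
lemma OneSparse.sum_abs_div_sq (i : Fin K) (g : Fin d → ℝ) :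
    (∑ j, |B.x i j| / g j) ^ 2 = ∑ j, B.x i j ^ 2 / g j ^ 2 := by
  by_cases h : ∃ j, B.x i j ≠ 0
  · obtain ⟨j, hj⟩ := h
    have h0 : ∀ k, k ≠ j → B.x i k = 0 := fun k hk => by
      by_contra h2
      exact hk (hs i k j h2 hj)
    rw [Finset.sum_eq_single j (fun k _ hk => by simp [h0 k hk]) (by simp),
      Finset.sum_eq_single j (fun k _ hk => by simp [h0 k hk]) (by simp), div_pow, sq_abs]
  · push Not at h
    simp [h]

lemma OneSparse.width_sq (arm : ℕ → Fin K) (t : ℕ) (i : Fin K) :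
    B.width arm t i ^ 2 = ∑ j, B.x i j ^ 2 / B.info arm t j := by
  rw [width, hs.sum_abs_div_sq]
  exact Finset.sum_congr rfl fun j _ => by rw [Real.sq_sqrt (B.info_nonneg arm t j)]

end Width

lemma width_nonneg (arm : ℕ → Fin K) (t : ℕ) (i : Fin K) : 0 ≤ B.width arm t i :=
  Finset.sum_nonneg fun _ _ => by positivity

lemma OneSparse.width_le_one {B : GLMBandit d K} (hs : B.OneSparse) {arm : ℕ → Fin K} {t : ℕ}
    (h : ∀ j, 1 ≤ B.info arm t j) (i : Fin K) : B.width arm t i ≤ 1 := by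
  refine (sq_le_one_iff₀ (B.width_nonneg arm t i)).1 ?_
  rw [hs.width_sq]
  refine le_trans (Finset.sum_le_sum fun j _ => ?_) (B.sum_sq_le_one i)
  exact div_le_self (sq_nonneg _) (h j)

lemma half_le_log_one_add {x : ℝ} (h0 : 0 ≤ x) (h1 : x ≤ 1) : x / 2 ≤ Real.log (1 + x) := by
  have h := Real.one_sub_inv_le_log_of_pos (show 0 < 1 + x by linarith)
  refine le_trans ?_ h
  have : 1 - (1 + x)⁻¹ = x / (1 + x) := by field_simp; ring
  rw [this]
  gcongr
  linarith

/-- The elliptical potential bound for a diagonal Gram matrix. -/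
lemma OneSparse.sum_width_le {B : GLMBandit d K} (hs : B.OneSparse) (hd : 1 ≤ d)
    {arm : ℕ → Fin K} {τ n : ℕ} (hτ : 1 ≤ τ) (hτn : τ ≤ n) (h : ∀ j, 1 ≤ B.info arm τ j) :
    ∑ t ∈ Finset.Ioc τ n, B.width arm t (arm t) ≤ √(2 * d * n * Real.log (n / d)) := by
  have hd' : (0 : ℝ) < d := by exact_mod_cast hd
  have hn' : (0 : ℝ) < n := by exact_mod_cast (by omega : 0 < n)
  have hpos : ∀ t, τ ≤ t → ∀ j, 1 ≤ B.info arm t j := fun t ht j =>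
    (h j).trans (B.info_mono arm ht j)
  -- As g ≥ 1, the ratio x²/g lies in [0, 1] and is at most twice log(1 + x²/g), the increment of
  -- log g. The log-determinant therefore telescopes.
  have hstep : ∀ t, τ < t → B.width arm t (arm t) ^ 2 ≤
      2 * (∑ j, Real.log (B.info arm (t + 1) j)) - 2 * ∑ j, Real.log (B.info arm t j) := by
    intro t ht
    rw [hs.width_sq, ← mul_sub, ← Finset.sum_sub_distrib, Finset.mul_sum]
    refine Finset.sum_le_sum fun j _ => ?_
    have hg := hpos t ht.le j
    have hx : B.x (arm t) j ^ 2 ≤ 1 :=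
      (Finset.single_le_sum (f := fun j => B.x (arm t) j ^ 2) (fun _ _ => sq_nonneg _)
        (Finset.mem_univ j)).trans (B.sum_sq_le_one _)
    have e : B.info arm (t + 1) j = B.info arm t j * (1 + B.x (arm t) j ^ 2 / B.info arm t j) := by
      rw [mul_add, mul_div_cancel₀ _ (by linarith), mul_one]
      exact Finset.sum_Ico_succ_top (by omega) _
    have hr0 : 0 ≤ B.x (arm t) j ^ 2 / B.info arm t j := by positivity
    have hr1 : B.x (arm t) j ^ 2 / B.info arm t j ≤ 1 := by
      rw [div_le_one (by linarith)]; linarith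
    rw [e, Real.log_mul (by linarith) (by linarith)]
    linarith [half_le_log_one_add hr0 hr1]
  have htel : ∀ m, τ ≤ m → ∑ t ∈ Finset.Ioc τ m, B.width arm t (arm t) ^ 2 ≤
      2 * (∑ j, Real.log (B.info arm (m + 1) j)) -
        2 * ∑ j, Real.log (B.info arm (τ + 1) j) := by
    intro m hm
    induction m, hm using Nat.le_induction with
    | base => simp
    | succ m hm ih =>
      rw [Finset.sum_Ioc_succ_top (by omega)]
      linarith [hstep (m + 1) (by omega)]
  have hlow : 0 ≤ ∑ j, Real.log (B.info arm (τ + 1) j) :=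
    Finset.sum_nonneg fun j _ => Real.log_nonneg (hpos _ (by omega) j)
  have hhigh : ∑ j, Real.log (B.info arm (n + 1) j) ≤ d * Real.log (n / d) := by
    -- The tangent of log at n/d plays the role of concavity, since the informations sum to at most
    -- n.
    have h1 : ∀ j, Real.log (B.info arm (n + 1) j) ≤
        Real.log (n / d) + (B.info arm (n + 1) j * (d / n) - 1) := by
      intro j
      have hg := hpos (n + 1) (by omega) j
      have h2 := Real.log_le_sub_one_of_pos (x := B.info arm (n + 1) j * (d / n)) (by positivity)
      rw [Real.log_mul (by linarith) (by positivity), Real.log_div (by positivity) (by positivity)]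
        at h2
      rw [Real.log_div (by positivity) (by positivity)]
      linarith
    refine (Finset.sum_le_sum fun j _ => h1 j).trans ?_
    rw [Finset.sum_add_distrib, Finset.sum_sub_distrib, ← Finset.sum_mul]
    have h3 := B.sum_info_le arm (t := n + 1) (by omega)
    push_cast at h3
    have h4 : (∑ j, B.info arm (n + 1) j) * (d / n) ≤ n * (d / n) := by
      gcongr; linarith
    rw [mul_div_cancel₀ _ hn'.ne'] at h4
    simp only [Finset.sum_const, Finset.card_univ, Fintype.card_fin, nsmul_eq_mul, mul_one]
    linarith
  refine Real.le_sqrt_of_sq_le ?_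
  have hcs := sq_sum_le_card_mul_sum_sq (s := Finset.Ioc τ n)
    (f := fun t => B.width arm t (arm t))
  refine hcs.trans ?_
  have h5 : ∑ t ∈ Finset.Ioc τ n, B.width arm t (arm t) ^ 2 ≤ 2 * (d * Real.log (n / d)) := by
    linarith [htel n hτn]
  have h6 : ((Finset.Ioc τ n).card : ℝ) ≤ n := by
    rw [Nat.card_Ioc]; exact_mod_cast Nat.sub_le _ _
  calc ((Finset.Ioc τ n).card : ℝ) * ∑ t ∈ Finset.Ioc τ n, B.width arm t (arm t) ^ 2
      ≤ n * (2 * (d * Real.log (n / d))) := by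
        refine mul_le_mul h6 h5 (Finset.sum_nonneg fun _ _ => sq_nonneg _) hn'.le
    _ = _ := by ring

end GLMBandit

/-! ### Deterministic accuracy of the estimate and of the greedy choice -/

namespace GLMBandit

variable {d K : ℕ} (B : GLMBandit d K)

section Estimate

variable (arm : ℕ → Fin K) (y : ℕ → ℝ) (t : ℕ)

/-- The `j`-th partial derivative of the negative log likelihood at a parameter vector with
`j`-th entry `z`. -/
noncomputable def partialLik (j : Fin d) (z : ℝ) : ℝ :=
  ∑ ℓ ∈ Finset.Ico 1 t, B.x (arm ℓ) j * (B.mean (B.x (arm ℓ) j * z) - y ℓ)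

lemma continuous_partialLik (j : Fin d) : Continuous (B.partialLik arm y t j) := by
  have := B.differentiable_mean.continuous
  unfold partialLik
  fun_prop

lemma mul_mean_mul_mono (s : ℝ) : Monotone fun z => s * B.mean (s * z) := by
  intro z w h
  rcases le_total 0 s with hs | hs
  · exact mul_le_mul_of_nonneg_left
      (B.strictMono_mean.monotone (mul_le_mul_of_nonneg_left h hs)) hs
  · exact mul_le_mul_of_nonpos_left
      (B.strictMono_mean.monotone (mul_le_mul_of_nonpos_left h hs)) hs

lemma mul_mean_mul_lt {s : ℝ} (hs : s ≠ 0) {z w : ℝ} (h : z < w) :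
    s * B.mean (s * z) < s * B.mean (s * w) := by
  rcases lt_or_gt_of_ne hs with hs | hs
  · exact mul_lt_mul_of_neg_left (B.strictMono_mean (mul_lt_mul_of_neg_left h hs)) hs
  · exact mul_lt_mul_of_pos_left (B.strictMono_mean (mul_lt_mul_of_pos_left h hs)) hs

lemma strictMono_partialLik {j : Fin d} (h : 0 < B.info arm t j) :
    StrictMono (B.partialLik arm y t j) := by
  intro z w hzw
  unfold partialLik
  simp only [mul_sub, Finset.sum_sub_distrib]
  refine sub_lt_sub_right (Finset.sum_lt_sum (fun ℓ _ => B.mul_mean_mul_mono _ hzw.le) ?_) _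
  by_contra! hc
  refine h.ne' (Finset.sum_eq_zero fun ℓ hℓ => ?_)
  by_contra h2
  exact absurd (B.mul_mean_mul_lt (s := B.x (arm ℓ) j) (by rintro h; simp [h] at h2) hzw)
    (not_lt.2 (hc ℓ hℓ))

variable {B} (hs : B.OneSparse)
include hs

lemma OneSparse.mul_comp_inner (f : ℝ → ℝ) (i : Fin K) (j : Fin d)
    (θ : EuclideanSpace ℝ (Fin d)) : B.x i j * f ⟪B.x i, θ⟫ = B.x i j * f (B.x i j * θ j) := by
  by_cases h : B.x i j = 0
  · simp [h]
  · rw [hs.inner_eq h]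

/-- Moving only coordinate j of `θstar` by at most one stays in the ball that defines `slopeMin`,
and by sparsity the predictor of arm i sees only that coordinate. -/
lemma OneSparse.mul_mean_mul_ge (i : Fin K) (j : Fin d) {z w : ℝ} (hzw : z ≤ w)
    (hz : B.θstar j - 1 ≤ z) (hw : w ≤ B.θstar j + 1) :
    B.x i j * B.mean (B.x i j * z) + B.slopeMin * (B.x i j ^ 2 * (w - z)) ≤
      B.x i j * B.mean (B.x i j * w) := by
  by_cases h : B.x i j = 0
  · simp [h]
  set s := B.x i j with hsdef
  have hderiv : ∀ v, HasDerivAt (fun v => s * B.mean (s * v) - B.slopeMin * (s ^ 2 * v))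
      (s * (deriv B.mean (s * v) * s) - B.slopeMin * s ^ 2) v := by
    intro v
    have h1 : HasDerivAt (fun v => s * v) s v := by simpa using (hasDerivAt_id v).const_mul s
    have h2 : HasDerivAt (fun v => B.mean (s * v)) (deriv B.mean (s * v) * s) v :=
      (B.differentiable_mean _).hasDerivAt.comp v h1
    have h3 : HasDerivAt (fun v => B.slopeMin * (s ^ 2 * v)) (B.slopeMin * s ^ 2) v := by
      simpa using ((hasDerivAt_id v).const_mul (s ^ 2)).const_mul B.slopeMin
    exact (h2.const_mul s).sub h3
  have hmono : MonotoneOn (fun v => s * B.mean (s * v) - B.slopeMin * (s ^ 2 * v))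
      (Set.Icc (B.θstar j - 1) (B.θstar j + 1)) := by
    refine monotoneOn_of_deriv_nonneg (convex_Icc _ _)
      (fun v _ => (hderiv v).continuousAt.continuousWithinAt)
      (fun v _ => (hderiv v).differentiableAt.differentiableWithinAt) fun v hv => ?_
    rw [interior_Icc] at hv
    rw [(hderiv v).deriv]
    have hle : B.slopeMin ≤ deriv B.mean (s * v) := by
      have := B.slopeMin_le (x := B.x i)
        (θ := B.θstar + EuclideanSpace.single j (v - B.θstar j)) (B.norm_x_le i) (by
          rw [add_sub_cancel_left, PiLp.norm_single, Real.norm_eq_abs, abs_le]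
          constructor <;> linarith [hv.1, hv.2])
      rw [hs.inner_eq h] at this
      simpa using this
    nlinarith [mul_le_mul_of_nonneg_right hle (sq_nonneg s)]
  have := hmono ⟨hz, hzw.trans hw⟩ ⟨hz.trans hzw, hw⟩ hzw
  simp only at this
  linarith

lemma OneSparse.partialLik_ge (j : Fin d) {z w : ℝ} (hzw : z ≤ w)
    (hz : B.θstar j - 1 ≤ z) (hw : w ≤ B.θstar j + 1) :
    B.partialLik arm y t j z + B.slopeMin * (B.info arm t j * (w - z)) ≤
      B.partialLik arm y t j w := by
  unfold partialLik info
  rw [Finset.sum_mul, Finset.mul_sum, ← Finset.sum_add_distrib]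
  refine Finset.sum_le_sum fun ℓ _ => ?_
  have := hs.mul_mean_mul_ge (arm ℓ) j hzw hz hw
  linarith

lemma OneSparse.partialLik_θstar (j : Fin d) :
    B.partialLik arm y t j (B.θstar j) =
      -B.score arm (fun ℓ => y ℓ - B.mean ⟪B.x (arm ℓ), B.θstar⟫) t j := by
  unfold partialLik score
  rw [← Finset.sum_neg_distrib]
  refine Finset.sum_congr rfl fun ℓ _ => ?_
  have := hs.mul_comp_inner B.mean (arm ℓ) j B.θstar
  linarith

/-- Each observation contributes at least its tangent line by convexity of b, and the tangent terms
add up to the gradient paired with the displacement, which vanishes. -/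
lemma OneSparse.isMinOn_of_partialLik_eq_zero {θ : EuclideanSpace ℝ (Fin d)}
    (hθ : ∀ j, B.partialLik arm y t j (θ j) = 0) :
    IsMinOn (negLogLik B.b B.c (Finset.Ico 1 t) (fun ℓ => B.x (arm ℓ)) y) Set.univ θ := by
  intro θ₂ _
  show negLogLik B.b B.c (Finset.Ico 1 t) (fun ℓ => B.x (arm ℓ)) y θ ≤
    negLogLik B.b B.c (Finset.Ico 1 t) (fun ℓ => B.x (arm ℓ)) y θ₂
  have h0 : ∑ ℓ ∈ Finset.Ico 1 t, (B.mean ⟪B.x (arm ℓ), θ⟫ - y ℓ) * ⟪B.x (arm ℓ), θ₂ - θ⟫ = 0 := by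
    have h1 : ∀ ℓ, (B.mean ⟪B.x (arm ℓ), θ⟫ - y ℓ) * ⟪B.x (arm ℓ), θ₂ - θ⟫ =
        ∑ j, (θ₂ - θ) j * (B.x (arm ℓ) j * (B.mean (B.x (arm ℓ) j * θ j) - y ℓ)) := by
      intro ℓ
      rw [PiLp.inner_apply _ (θ₂ - θ), Finset.mul_sum]
      refine Finset.sum_congr rfl fun j _ => ?_
      have := hs.mul_comp_inner (fun v => B.mean v - y ℓ) (arm ℓ) j θ
      simp only [RCLike.inner_apply, conj_trivial]
      linear_combination (θ₂ - θ) j * this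
    simp only [h1]
    rw [Finset.sum_comm]
    refine Finset.sum_eq_zero fun j _ => ?_
    rw [← Finset.mul_sum]
    have := hθ j
    unfold partialLik at this
    rw [this, mul_zero]
  rw [← sub_nonneg, ← h0]
  unfold negLogLik
  rw [← Finset.sum_sub_distrib]
  refine Finset.sum_le_sum fun ℓ _ => ?_
  have := B.b_tangent_le ⟪B.x (arm ℓ), θ⟫ ⟪B.x (arm ℓ), θ₂⟫
  rw [inner_sub_right]
  linarith

lemma OneSparse.partialLik_eq_zero_of_isMinOn {θ : EuclideanSpace ℝ (Fin d)}
    (hθ : IsMinOn (negLogLik B.b B.c (Finset.Ico 1 t) (fun ℓ => B.x (arm ℓ)) y) Set.univ θ)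
    (j : Fin d) : B.partialLik arm y t j (θ j) = 0 := by
  set φ : ℝ → ℝ := fun r => negLogLik B.b B.c (Finset.Ico 1 t) (fun ℓ => B.x (arm ℓ)) y
    (θ + EuclideanSpace.single j r) with hφ
  have hin : ∀ ℓ r, ⟪B.x (arm ℓ), θ + EuclideanSpace.single j r⟫ =
      ⟪B.x (arm ℓ), θ⟫ + B.x (arm ℓ) j * r := by
    intro ℓ r
    rw [inner_add_right, EuclideanSpace.inner_single_right]
    simp [mul_comm]
  have hd : HasDerivAt φ (∑ ℓ ∈ Finset.Ico 1 t,
      (B.mean (⟪B.x (arm ℓ), θ⟫ + B.x (arm ℓ) j * 0) * B.x (arm ℓ) j -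
        y ℓ * B.x (arm ℓ) j)) 0 := by
    have e : φ = fun r => ∑ ℓ ∈ Finset.Ico 1 t, (B.b (⟪B.x (arm ℓ), θ⟫ + B.x (arm ℓ) j * r) -
        y ℓ * (⟪B.x (arm ℓ), θ⟫ + B.x (arm ℓ) j * r) - B.c (y ℓ)) := by
      funext r
      simp only [hφ, negLogLik, hin]
    rw [e]
    refine HasDerivAt.fun_sum fun ℓ _ => ?_
    have h1 : HasDerivAt (fun r => ⟪B.x (arm ℓ), θ⟫ + B.x (arm ℓ) j * r) (B.x (arm ℓ) j) 0 := by
      simpa using ((hasDerivAt_id (0 : ℝ)).const_mul (B.x (arm ℓ) j)).const_add ⟪B.x (arm ℓ), θ⟫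
    exact (((B.hasDerivAt_b _).comp (0 : ℝ) h1).sub (h1.const_mul (y ℓ))).sub_const _
  have hmin : IsLocalMin φ 0 := by
    refine Filter.Eventually.of_forall fun r => ?_
    have h2 := hθ (Set.mem_univ (θ + EuclideanSpace.single j r))
    have h3 : φ 0 = negLogLik B.b B.c (Finset.Ico 1 t) (fun ℓ => B.x (arm ℓ)) y θ := by
      have : EuclideanSpace.single j (0 : ℝ) = (0 : EuclideanSpace ℝ (Fin d)) := by ext k; simp
      simp only [hφ, this, add_zero]
    rw [h3]
    exact h2
  have hz := hmin.hasDerivAt_eq_zero hd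
  rw [← hz]
  unfold partialLik
  refine Finset.sum_congr rfl fun ℓ _ => ?_
  have := hs.mul_comp_inner B.mean (arm ℓ) j θ
  rw [mul_zero, add_zero]
  linarith

/-- If the residual scores are small, then the maximum likelihood estimate exists and every such
estimate is close to `θstar`. -/
theorem OneSparse.estimate_close {ρ : Fin d → ℝ} (hρ : ∀ j, ρ j ≤ 1)
    (hinfo : ∀ j, 0 < B.info arm t j)
    (hV : ∀ j, |B.score arm (fun ℓ => y ℓ - B.mean ⟪B.x (arm ℓ), B.θstar⟫) t j| ≤
      B.slopeMin * (B.info arm t j * ρ j)) :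
    (∃ θ, IsMinOn (negLogLik B.b B.c (Finset.Ico 1 t) (fun ℓ => B.x (arm ℓ)) y) Set.univ θ) ∧
    ∀ θ, IsMinOn (negLogLik B.b B.c (Finset.Ico 1 t) (fun ℓ => B.x (arm ℓ)) y) Set.univ θ →
      ∀ j, |θ j - B.θstar j| ≤ ρ j ∧
        (0 ≤ B.score arm (fun ℓ => y ℓ - B.mean ⟪B.x (arm ℓ), B.θstar⟫) t j →
          B.θstar j ≤ θ j) ∧
        (B.score arm (fun ℓ => y ℓ - B.mean ⟪B.x (arm ℓ), B.θstar⟫) t j ≤ 0 →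
          θ j ≤ B.θstar j) := by
  have hρ0 : ∀ j, 0 ≤ ρ j := by
    intro j
    have h := (abs_nonneg _).trans (hV j)
    by_contra! hc
    have := mul_pos B.slopeMin_pos (mul_pos (hinfo j) (neg_pos.2 hc))
    linarith
  have hstar := fun j => hs.partialLik_θstar arm y t j
  -- The partial derivative at `θstar` is minus the score, and a displacement ρ_j changes it by at
  -- least slopeMin · g_j · ρ_j, enough to cross zero on either side.
  have hup : ∀ j, 0 ≤ B.partialLik arm y t j (B.θstar j + ρ j) := by
    intro j
    have h1 := hs.partialLik_ge arm y t j (z := B.θstar j) (w := B.θstar j + ρ j)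
      (by linarith [hρ0 j]) (by linarith) (by linarith [hρ j])
    rw [hstar, add_sub_cancel_left] at h1
    linarith [(abs_le.1 (hV j)).2]
  have hlo : ∀ j, B.partialLik arm y t j (B.θstar j - ρ j) ≤ 0 := by
    intro j
    have h1 := hs.partialLik_ge arm y t j (z := B.θstar j - ρ j) (w := B.θstar j)
      (by linarith [hρ0 j]) (by linarith [hρ j]) (by linarith)
    rw [hstar, sub_sub_cancel] at h1
    linarith [(abs_le.1 (hV j)).1]
  have hmono := fun j => B.strictMono_partialLik arm y t (hinfo j)
  refine ⟨?_, fun θ hθ j => ?_⟩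
  · have hroot : ∀ j, ∃ z, B.partialLik arm y t j z = 0 := by
      intro j
      obtain ⟨z, -, hz⟩ := intermediate_value_Icc
        (show B.θstar j - ρ j ≤ B.θstar j + ρ j by linarith [hρ0 j])
        (B.continuous_partialLik arm y t j).continuousOn ⟨hlo j, hup j⟩
      exact ⟨z, hz⟩
    choose z hz using hroot
    exact ⟨WithLp.toLp 2 z, hs.isMinOn_of_partialLik_eq_zero arm y t hz⟩
  · have h0 := hs.partialLik_eq_zero_of_isMinOn arm y t hθ j
    refine ⟨abs_le.2 ⟨?_, ?_⟩, fun h => ?_, fun h => ?_⟩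
    · linarith [(hmono j).le_iff_le.1 ((hlo j).trans h0.ge)]
    · linarith [(hmono j).le_iff_le.1 (h0.le.trans (hup j))]
    · refine (hmono j).le_iff_le.1 ?_
      rw [h0, hstar]
      linarith
    · refine (hmono j).le_iff_le.1 ?_
      rw [h0, hstar]
      linarith

end Estimate

/-- The width of the least uncertain arm whose gap is not resolved. -/
noncomputable def minWidth (C : ℝ) (arm : ℕ → Fin K) (t : ℕ) : ℝ :=
  Finset.univ.inf' ⟨B.best, Finset.mem_univ _⟩ fun i =>
    -- Resolved arms receive a neutral value: for C ≥ 0 the best arm has zero gap and is itself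
    -- always unresolved.
    if B.linGap i ≤ C * B.width arm t i then B.width arm t i else B.width arm t B.best

section Greedy

variable {C : ℝ} (hC : 0 ≤ C) {arm : ℕ → Fin K} {t : ℕ}

lemma minWidth_nonneg : 0 ≤ B.minWidth C arm t := by
  refine Finset.le_inf' _ _ fun i _ => ?_
  split_ifs <;> exact B.width_nonneg _ _ _

lemma minWidth_le {i : Fin K} (h : B.linGap i ≤ C * B.width arm t i) :
    B.minWidth C arm t ≤ B.width arm t i := by
  refine (Finset.inf'_le _ (Finset.mem_univ i)).trans ?_
  rw [if_pos h]

include hC in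
lemma exists_minWidth_eq :
    ∃ i, B.linGap i ≤ C * B.width arm t i ∧ B.minWidth C arm t = B.width arm t i := by
  obtain ⟨i, -, hi⟩ := Finset.exists_mem_eq_inf' (s := Finset.univ) ⟨B.best, Finset.mem_univ _⟩
    fun i => if B.linGap i ≤ C * B.width arm t i then B.width arm t i else B.width arm t B.best
  by_cases h : B.linGap i ≤ C * B.width arm t i
  · rw [if_pos h] at hi
    exact ⟨i, h, hi⟩
  · rw [if_neg h] at hi
    refine ⟨B.best, ?_, hi⟩
    rw [linGap_best]
    exact mul_nonneg hC (B.width_nonneg _ _ _)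

variable {θ : EuclideanSpace ℝ (Fin d)}
  (hθ : ∀ j, |θ j - B.θstar j| ≤ C / √(B.info arm t j))

include hθ in
lemma abs_inner_sub_le (i : Fin K) : |⟪B.x i, θ⟫ - ⟪B.x i, B.θstar⟫| ≤ C * B.width arm t i := by
  rw [← inner_sub_right, PiLp.inner_apply, width, Finset.mul_sum]
  refine (Finset.abs_sum_le_sum_abs _ _).trans (Finset.sum_le_sum fun j _ => ?_)
  simp only [RCLike.inner_apply, conj_trivial, abs_mul]
  have := mul_le_mul_of_nonneg_right (hθ j) (abs_nonneg (B.x i j))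
  refine this.trans (le_of_eq ?_)
  ring

include hC hθ in
/-- The gap of a greedy arm under an accurate estimate. -/
lemma linGap_greedy_le {i : Fin K} (hi : ∀ k, ⟪B.x k, θ⟫ ≤ ⟪B.x i, θ⟫) :
    B.linGap i ≤ C * (2 * B.minWidth C arm t + B.width arm t i) := by
  -- The arm k enters twice, through its gap and through its estimation error, hence the factor 2.
  obtain ⟨k, hk, hkw⟩ := B.exists_minWidth_eq hC (arm := arm) (t := t)
  have h1 := abs_le.1 (B.abs_inner_sub_le hθ i)
  have h2 := abs_le.1 (B.abs_inner_sub_le hθ k)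
  have h3 := hi k
  rw [hkw]
  unfold linGap at *
  linarith

include hθ in
/-- A greedy arm is not resolved if the estimate for the best arm is optimistic. -/
lemma minWidth_le_width_greedy {i : Fin K} (hi : ∀ k, ⟪B.x k, θ⟫ ≤ ⟪B.x i, θ⟫)
    (hopt : ⟪B.x B.best, B.θstar⟫ ≤ ⟪B.x B.best, θ⟫) :
    B.minWidth C arm t ≤ B.width arm t i := by
  refine B.minWidth_le ?_
  have h1 := abs_le.1 (B.abs_inner_sub_le hθ i)
  have h2 := hi B.best
  unfold linGap
  linarith

end Greedy

end GLMBandit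

/-! ### Gaussian sums and the Gaussian mixture integral -/

section GaussianLemmas

variable {Ω : Type*} [MeasurableSpace Ω] {P : Measure Ω} [IsProbabilityMeasure P]

lemma map_sum_gaussianReal {ι : Type*} [Fintype ι] {X : ι → Ω → ℝ} {v : NNReal}
    (hm : ∀ i, Measurable (X i)) (hlaw : ∀ i, P.map (X i) = gaussianReal 0 v)
    (hind : iIndepFun X P) (c : ι → ℝ) :
    P.map (fun ω => ∑ i, c i * X i ω) = gaussianReal 0 ((∑ i, c i ^ 2).toNNReal * v) := by
  have hind' : iIndepFun (fun i ω => c i * X i ω) P :=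
    hind.comp (fun i x => c i * x) fun i => measurable_const_mul _
  have hm' : ∀ i, Measurable fun ω => c i * X i ω := fun i => (hm i).const_mul _
  have key : ∀ s : Finset ι, P.map (∑ i ∈ s, fun ω => c i * X i ω) =
      gaussianReal 0 ((∑ i ∈ s, c i ^ 2).toNNReal * v) := by
    intro s
    induction s using Finset.cons_induction with
    | empty =>
      simp only [Finset.sum_empty, Real.toNNReal_zero, zero_mul, gaussianReal_zero_var]
      exact (Measure.map_const P (0 : ℝ)).trans (by simp)
    | cons i s hi ih =>
      have h1 : P.map (fun ω => c i * X i ω) = gaussianReal 0 ((c i ^ 2).toNNReal * v) := by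
        have := gaussianReal_map_const_mul (μ := 0) (v := v) (c i)
        rw [← hlaw i, Measure.map_map (measurable_const_mul _) (hm i), mul_zero] at this
        refine this.trans ?_
        congr 2
        ext
        simp [sq_nonneg]
      rw [Finset.sum_cons, Finset.sum_cons, add_comm,
        gaussianReal_add_gaussianReal_of_indepFun
          (hind'.indepFun_finsetSum_of_notMem hm' hi) ih h1, add_zero, ← add_mul, add_comm,
        Real.toNNReal_add (sq_nonneg _) (Finset.sum_nonneg fun _ _ => sq_nonneg _)]
  have := key Finset.univ
  rw [← this]
  congr 1
  ext ω
  simp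

lemma gaussianReal_eq_map_standard (c : ℝ) :
    gaussianReal 0 (c ^ 2).toNNReal = (gaussianReal 0 1).map fun z => c * z := by
  rw [gaussianReal_map_const_mul, mul_zero, mul_one]
  congr 1
  ext
  simp [sq_nonneg]

/-- The Gaussian mixture of the exponential supermartingale. -/
lemma lintegral_exp_gaussianReal {σ g : ℝ} (hσ : 0 < σ) (hg : 0 ≤ g) (N : ℝ) :
    ∫⁻ l, ENNReal.ofReal (Real.exp (l * N - l ^ 2 * σ ^ 2 * g / 2))
      ∂(gaussianReal 0 (2 / σ ^ 2).toNNReal) =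
    ENNReal.ofReal (Real.exp (N ^ 2 / (σ ^ 2 * (2 * g + 1))) / √(1 + 2 * g)) := by
  have hv : (2 / σ ^ 2).toNNReal ≠ 0 := by
    rw [Ne, Real.toNNReal_eq_zero, not_le]; positivity
  have hw : (2 / (σ ^ 2 * (2 * g + 1))).toNNReal ≠ 0 := by
    rw [Ne, Real.toNNReal_eq_zero, not_le]; positivity
  -- Completing the square turns the integrand into a constant times the Gaussian density with mean
  -- 2N / (σ²(2g + 1)) and variance 2 / (σ²(2g + 1)).
  rw [gaussianReal_of_var_ne_zero _ hv,
    lintegral_withDensity_eq_lintegral_mul _ (measurable_gaussianPDF _ _) (by fun_prop),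
    ← mul_one (ENNReal.ofReal (_ / _)),
    ← lintegral_gaussianPDF_eq_one (2 * N / (σ ^ 2 * (2 * g + 1))) hw,
    ← lintegral_const_mul _ (measurable_gaussianPDF _ _)]
  refine lintegral_congr fun l => ?_
  rw [Pi.mul_apply, gaussianPDF_def, gaussianPDF_def]
  beta_reduce
  rw [← ENNReal.ofReal_mul (gaussianPDFReal_nonneg _ _ _), ← ENNReal.ofReal_mul (by positivity)]
  congr 1
  rw [gaussianPDFReal_def, gaussianPDFReal_def]
  beta_reduce
  rw [Real.coe_toNNReal _ (by positivity), Real.coe_toNNReal _ (by positivity)]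
  have e1 : (√(2 * Real.pi * (2 / (σ ^ 2 * (2 * g + 1)))))⁻¹ =
      √(1 + 2 * g) * (√(2 * Real.pi * (2 / σ ^ 2)))⁻¹ := by
    rw [← Real.sqrt_inv, ← Real.sqrt_inv, ← Real.sqrt_mul (by positivity)]
    congr 1
    field_simp
    ring
  have hsq : √(1 + 2 * g) ≠ 0 := by positivity
  rw [e1, mul_assoc, ← Real.exp_add, div_mul_eq_mul_div, eq_div_iff hsq]
  have e2 : Real.exp (-(l - 0) ^ 2 / (2 * (2 / σ ^ 2)) + (l * N - l ^ 2 * σ ^ 2 * g / 2)) =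
      Real.exp (N ^ 2 / (σ ^ 2 * (2 * g + 1))) *
      Real.exp (-(l - 2 * N / (σ ^ 2 * (2 * g + 1))) ^ 2 / (2 * (2 / (σ ^ 2 * (2 * g + 1))))) := by
    rw [← Real.exp_add]
    congr 1
    field_simp
    ring
  rw [e2]
  ring

end GaussianLemmas

/-! ### Noise supermartingale and conditional law of the perturbation -/

namespace GLMBandit

variable {d K : ℕ} (B : GLMBandit d K)

/-- The accumulated reward noise in the `j`-th coordinate. -/
noncomputable def noise (arm : ℕ → Fin K) (y : ℕ → ℝ) (t : ℕ) (j : Fin d) : ℝ :=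
  B.score arm (fun ℓ => y ℓ - B.mean ⟪B.x (arm ℓ), B.θstar⟫) t j

section Congr

variable {arm arm' : ℕ → Fin K} {y y' : ℕ → ℝ} {t : ℕ}

lemma info_congr (h : ∀ ℓ ∈ Finset.Ico 1 t, arm ℓ = arm' ℓ) (j : Fin d) :
    B.info arm t j = B.info arm' t j :=
  Finset.sum_congr rfl fun ℓ hℓ => by rw [h ℓ hℓ]

lemma width_congr (h : ∀ ℓ ∈ Finset.Ico 1 t, arm ℓ = arm' ℓ) (i : Fin K) :
    B.width arm t i = B.width arm' t i := by
  simp only [width, B.info_congr h]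

lemma minWidth_congr (C : ℝ) (h : ∀ ℓ ∈ Finset.Ico 1 t, arm ℓ = arm' ℓ) :
    B.minWidth C arm t = B.minWidth C arm' t := by
  simp only [minWidth, B.width_congr h]

lemma score_congr (h : ∀ ℓ ∈ Finset.Ico 1 t, arm ℓ = arm' ℓ)
    (hy : ∀ ℓ ∈ Finset.Ico 1 t, y ℓ = y' ℓ) (j : Fin d) :
    B.score arm y t j = B.score arm' y' t j :=
  Finset.sum_congr rfl fun ℓ hℓ => by rw [h ℓ hℓ, hy ℓ hℓ]

lemma noise_congr (h : ∀ ℓ ∈ Finset.Ico 1 t, arm ℓ = arm' ℓ)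
    (hy : ∀ ℓ ∈ Finset.Ico 1 t, y ℓ = y' ℓ) (j : Fin d) :
    B.noise arm y t j = B.noise arm' y' t j :=
  B.score_congr h (fun ℓ hℓ => by rw [h ℓ hℓ, hy ℓ hℓ]) j

end Congr

/-- The arms of a history, extended by the best arm. -/
def pastArm {t : ℕ} (h : Finset.Ico 1 t → Fin K × ℝ) (ℓ : ℕ) : Fin K :=
  if hl : ℓ ∈ Finset.Ico 1 t then (h ⟨ℓ, hl⟩).1 else B.best

/-- The rewards of a history, extended by zero. -/
noncomputable def pastReward {t : ℕ} (h : Finset.Ico 1 t → Fin K × ℝ) (ℓ : ℕ) : ℝ :=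
  if hl : ℓ ∈ Finset.Ico 1 t then (h ⟨ℓ, hl⟩).2 else 0

lemma measurable_pastArm {t : ℕ} (ℓ : ℕ) :
    Measurable fun h : Finset.Ico 1 t → Fin K × ℝ => B.pastArm h ℓ := by
  unfold pastArm
  split_ifs <;> fun_prop

lemma measurable_pastReward {t : ℕ} (ℓ : ℕ) :
    Measurable fun h : Finset.Ico 1 t → Fin K × ℝ => pastReward h ℓ := by
  unfold pastReward
  split_ifs <;> fun_prop

lemma measurable_info_past (t : ℕ) (j : Fin d) :
    Measurable fun h : Finset.Ico 1 t → Fin K × ℝ => B.info (B.pastArm h) t j :=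
  Finset.measurable_sum _ fun ℓ _ =>
    ((Measurable.of_discrete (f := fun i => B.x i j)).comp (B.measurable_pastArm ℓ)).pow_const 2

lemma measurable_width_past (t : ℕ) (i : Fin K) :
    Measurable fun h : Finset.Ico 1 t → Fin K × ℝ => B.width (B.pastArm h) t i :=
  Finset.measurable_sum _ fun j _ =>
    measurable_const.div (Real.continuous_sqrt.measurable.comp (B.measurable_info_past t j))

/-- Only the arms matter, and the arm sequences form a finite discrete space, so the rewards may be
replaced by zero. -/
lemma measurable_minWidth_past (C : ℝ) (t : ℕ) :
    Measurable fun h : Finset.Ico 1 t → Fin K × ℝ => B.minWidth C (B.pastArm h) t := by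
  have hπ : Measurable fun (h : Finset.Ico 1 t → Fin K × ℝ) ℓ => (h ℓ).1 :=
    measurable_pi_lambda _ fun ℓ => (measurable_pi_apply ℓ).fst
  have hG := (Measurable.of_discrete (f := fun k : Finset.Ico 1 t → Fin K =>
    B.minWidth C (B.pastArm fun ℓ => (k ℓ, (0 : ℝ))) t)).comp hπ
  have e : ∀ h : Finset.Ico 1 t → Fin K × ℝ,
      B.pastArm h = B.pastArm fun ℓ => ((h ℓ).1, (0 : ℝ)) := fun h => rfl
  simp_rw [e]
  exact hG

lemma measurable_noise_past (t : ℕ) (j : Fin d) :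
    Measurable fun h : Finset.Ico 1 t → Fin K × ℝ =>
      B.noise (B.pastArm h) (pastReward h) t j := by
  unfold noise score
  exact Finset.measurable_fun_sum _ fun ℓ _ =>
    ((Measurable.of_discrete (f := fun i => B.x i j)).comp (B.measurable_pastArm ℓ)).fun_mul
      ((measurable_pastReward ℓ).fun_sub ((Measurable.of_discrete
        (f := fun i => B.mean ⟪B.x i, B.θstar⟫)).comp (B.measurable_pastArm ℓ)))

section History

variable {Ω : Type*} {Y : Fin K → ℕ → Ω → ℝ} {I : ℕ → Ω → Fin K} {t : ℕ}

lemma pastArm_history (ω : Ω) : ∀ ℓ ∈ Finset.Ico 1 t, I ℓ ω = B.pastArm (history Y I t ω) ℓ := by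
  intro ℓ hℓ
  simp only [pastArm, dif_pos hℓ, history]

lemma pastReward_history (ω : Ω) :
    ∀ ℓ ∈ Finset.Ico 1 t, Y (I ℓ ω) ℓ ω = pastReward (history Y I t ω) ℓ := by
  intro ℓ hℓ
  simp only [pastReward, dif_pos hℓ, history]

end History

namespace IsGLMFPL

variable {B} {Ω : Type*} [MeasurableSpace Ω] {P : Measure Ω} [IsProbabilityMeasure P]
  {n τ : ℕ} {a : ℝ} {Y : Fin K → ℕ → Ω → ℝ} {Z : ℕ → ℕ → Ω → ℝ}
  {θ' : ℕ → Ω → EuclideanSpace ℝ (Fin d)} {I : ℕ → Ω → Fin K}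
  (H : B.IsGLMFPL P n τ a Y Z θ' I)
include H

omit [IsProbabilityMeasure P] in
lemma measurable_history {t : ℕ} (ht : t ≤ n + 1) : Measurable (history Y I t) := by
  refine measurable_pi_lambda _ fun ℓ => ?_
  obtain ⟨h1, h2⟩ := Finset.mem_Ico.1 ℓ.2
  have hmem : (ℓ : ℕ) ∈ Finset.Icc 1 n := Finset.mem_Icc.2 ⟨h1, by omega⟩
  refine (H.measurable_I ℓ hmem).prodMk ?_
  have h3 : Measurable fun p : Fin K × (Fin K → ℝ) => p.2 p.1 :=
    measurable_from_prod_countable_right fun i => measurable_pi_apply i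
  exact h3.comp ((H.measurable_I ℓ hmem).prodMk
    (measurable_pi_lambda _ fun i => H.measurable_Y i ℓ hmem))

omit [IsProbabilityMeasure P] in
lemma lintegral_exp_reward_le {t : ℕ} (ht : t ∈ Finset.Icc 1 n) (i : Fin K) (c : ℝ) :
    ∫⁻ ω, ENNReal.ofReal (Real.exp (c * (Y i t ω - B.mean ⟪B.x i, B.θstar⟫) -
      c ^ 2 * B.σ ^ 2 / 2)) ∂P ≤ 1 := by
  have hsub := B.subgaussian i
  rw [← H.law_Y i t ht] at hsub
  have hsub' : HasSubgaussianMGF (fun ω => Y i t ω - B.mean ⟪B.x i, B.θstar⟫)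
      (B.σ ^ 2).toNNReal P := hsub.of_map (H.measurable_Y i t ht).aemeasurable
  have hint := hsub'.integrable_exp_mul c
  have hle := hsub'.mgf_le c
  rw [Real.coe_toNNReal _ (sq_nonneg _)] at hle
  simp_rw [Real.exp_sub, div_eq_mul_inv]
  rw [← ofReal_integral_eq_lintegral_ofReal (hint.mul_const _)
    (Filter.Eventually.of_forall fun ω => by positivity), integral_mul_const]
  rw [← ENNReal.ofReal_one]
  refine ENNReal.ofReal_le_ofReal ?_
  rw [← div_eq_mul_inv, div_le_one (by positivity)]
  refine le_trans hle (le_of_eq ?_)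
  congr 1
  ring

/-- The exponential supermartingale of the noise. -/
lemma lintegral_exp_noise_le (l : ℝ) (j : Fin d) {t : ℕ} (ht : t ≤ n + 1) :
    ∫⁻ ω, ENNReal.ofReal (Real.exp (l * B.noise (fun ℓ => I ℓ ω) (fun ℓ => Y (I ℓ ω) ℓ ω) t j -
      l ^ 2 * B.σ ^ 2 * B.info (fun ℓ => I ℓ ω) t j / 2)) ∂P ≤ 1 := by
  induction t with
  | zero => simp [noise, score, info]
  | succ t ih =>
    rcases Nat.eq_zero_or_pos t with h0 | h0
    · subst h0
      simp [noise, score, info]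
    have htn : t ∈ Finset.Icc 1 n := Finset.mem_Icc.2 ⟨h0, by omega⟩
    set M : Ω → ENNReal := fun ω => ENNReal.ofReal (Real.exp
      (l * B.noise (fun ℓ => I ℓ ω) (fun ℓ => Y (I ℓ ω) ℓ ω) t j -
        l ^ 2 * B.σ ^ 2 * B.info (fun ℓ => I ℓ ω) t j / 2)) with hM
    -- Splitting by the pulled arm: φ carries the past and the choice of arm i, ψ the reward of a
    -- fixed arm i. These are independent, so the sub-Gaussian bound applies arm by arm.
    let φ : Fin K → ((Finset.Ico 1 t → Fin K × ℝ) × Fin K) → ENNReal := fun i p =>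
      ENNReal.ofReal (Real.exp (l * B.noise (B.pastArm p.1) (pastReward p.1) t j -
        l ^ 2 * B.σ ^ 2 * B.info (B.pastArm p.1) t j / 2)) * (if p.2 = i then 1 else 0)
    let ψ : Fin K → (Fin K → ℝ) → ENNReal := fun i y =>
      ENNReal.ofReal (Real.exp (l * B.x i j * (y i - B.mean ⟪B.x i, B.θstar⟫) -
        (l * B.x i j) ^ 2 * B.σ ^ 2 / 2))
    have hφ : ∀ i, Measurable (φ i) := by
      intro i
      have h1 := (B.measurable_noise_past t j).comp
        (measurable_fst : Measurable fun p : (Finset.Ico 1 t → Fin K × ℝ) × Fin K => p.1)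
      have h2 := (B.measurable_info_past t j).comp
        (measurable_fst : Measurable fun p : (Finset.Ico 1 t → Fin K × ℝ) × Fin K => p.1)
      refine Measurable.mul ?_ (Measurable.ite (measurable_snd (measurableSet_singleton i))
        measurable_const measurable_const)
      exact (Real.measurable_exp.comp ((h1.const_mul l).sub
        ((h2.const_mul (l ^ 2 * B.σ ^ 2)).div_const 2))).ennreal_ofReal
    have hψ : ∀ i, Measurable (ψ i) := by
      intro i
      fun_prop
    have hHm := (H.measurable_history (t := t) (by omega)).prodMk (H.measurable_I t htn)
    have hYm : Measurable fun ω i => Y i t ω :=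
      measurable_pi_lambda _ fun i => H.measurable_Y i t htn
    have hstep : ∀ ω, ENNReal.ofReal (Real.exp
        (l * B.noise (fun ℓ => I ℓ ω) (fun ℓ => Y (I ℓ ω) ℓ ω) (t + 1) j -
          l ^ 2 * B.σ ^ 2 * B.info (fun ℓ => I ℓ ω) (t + 1) j / 2)) =
        ∑ i, φ i (history Y I t ω, I t ω) * ψ i (fun i => Y i t ω) := by
      intro ω
      rw [Finset.sum_eq_single (I t ω)]
      · simp only [φ, ψ, if_true, mul_one]
        rw [← ENNReal.ofReal_mul (by positivity), ← Real.exp_add,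
          ← B.noise_congr (B.pastArm_history ω) (pastReward_history ω) j,
          ← B.info_congr (B.pastArm_history ω) j]
        congr 2
        simp only [noise, score, info]
        rw [Finset.sum_Ico_succ_top h0, Finset.sum_Ico_succ_top h0]
        ring
      · intro i _ hi
        simp [φ, hi.symm]
      · simp
    have hMφ : ∀ ω, M ω = ∑ i, φ i (history Y I t ω, I t ω) := by
      intro ω
      rw [Finset.sum_eq_single (I t ω)]
      · simp only [φ, if_true, mul_one, hM]
        rw [← B.noise_congr (B.pastArm_history ω) (pastReward_history ω) j,
          ← B.info_congr (B.pastArm_history ω) j]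
      · intro i _ hi
        simp [φ, hi.symm]
      · simp
    simp_rw [hstep]
    refine le_trans ?_ (ih (by omega))
    change _ ≤ ∫⁻ ω, M ω ∂P
    simp_rw [hMφ]
    have hm1 : ∀ i, Measurable fun ω => φ i (history Y I t ω, I t ω) := fun i =>
      (hφ i).comp hHm
    have hm2 : ∀ i, Measurable fun ω => ψ i (fun i => Y i t ω) := fun i => (hψ i).comp hYm
    rw [lintegral_finsetSum _ fun i _ => (hm1 i).fun_mul (hm2 i),
      lintegral_finsetSum _ fun i _ => hm1 i]
    refine Finset.sum_le_sum fun i _ => ?_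
    have hind := ((H.indep_Y t htn).comp (hψ i) (hφ i)).symm
    have := lintegral_mul_eq_lintegral_mul_lintegral_of_indepFun ((hφ i).comp hHm)
      ((hψ i).comp hYm) hind
    refine le_trans (le_of_eq this) ?_
    refine mul_le_of_le_one_right (zero_le) ?_
    exact H.lintegral_exp_reward_le htn i (l * B.x i j)

omit [IsProbabilityMeasure P] in
lemma measurable_noise {t : ℕ} (ht : t ≤ n + 1) (j : Fin d) :
    Measurable fun ω => B.noise (fun ℓ => I ℓ ω) (fun ℓ => Y (I ℓ ω) ℓ ω) t j := by
  have h := (B.measurable_noise_past t j).comp (H.measurable_history ht)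
  convert! h using 2 with ω
  exact B.noise_congr (B.pastArm_history ω) (pastReward_history ω) j

omit [IsProbabilityMeasure P] in
lemma measurable_info {t : ℕ} (ht : t ≤ n + 1) (j : Fin d) :
    Measurable fun ω => B.info (fun ℓ => I ℓ ω) t j := by
  have h := (B.measurable_info_past t j).comp (H.measurable_history ht)
  convert! h using 2 with ω
  exact B.info_congr (B.pastArm_history ω) j

/-- The method of mixtures. -/
lemma lintegral_mixture_le (j : Fin d) {t : ℕ} (ht : t ≤ n + 1) :
    ∫⁻ ω, ENNReal.ofReal (Real.exp (B.noise (fun ℓ => I ℓ ω) (fun ℓ => Y (I ℓ ω) ℓ ω) t j ^ 2 /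
      (B.σ ^ 2 * (2 * B.info (fun ℓ => I ℓ ω) t j + 1))) /
        √(1 + 2 * B.info (fun ℓ => I ℓ ω) t j)) ∂P ≤ 1 := by
  simp_rw [← lintegral_exp_gaussianReal B.σ_pos (B.info_nonneg _ t j)]
  rw [lintegral_lintegral_swap]
  · calc _ ≤ ∫⁻ _l, 1 ∂(gaussianReal 0 (2 / B.σ ^ 2).toNNReal) :=
        lintegral_mono fun l => H.lintegral_exp_noise_le l j ht
      _ = 1 := by simp
  · refine Measurable.aemeasurable ?_
    have h1 := (H.measurable_noise ht j).comp (measurable_fst : Measurable fun p : Ω × ℝ => p.1)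
    have h2 := (H.measurable_info ht j).comp (measurable_fst : Measurable fun p : Ω × ℝ => p.1)
    have h3 : Measurable fun p : Ω × ℝ => p.2 := measurable_snd
    exact (Real.measurable_exp.comp ((h3.mul h1).sub
      ((((h3.pow_const 2).mul_const _).mul h2).div_const 2))).ennreal_ofReal

/-- Given the history, the perturbation of a coordinate is Gaussian. -/
lemma lintegral_perturbation {t : ℕ} (ht : t ∈ Finset.Ioc τ n) (j : Fin d)
    {F : (Finset.Ico 1 t → Fin K × ℝ) × ℝ → ENNReal} (hF : Measurable F) :
    ∫⁻ ω, F (history Y I t ω, B.score (fun ℓ => I ℓ ω) (fun ℓ => Z t ℓ ω) t j) ∂P =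
    ∫⁻ ω, ∫⁻ z, F (history Y I t ω, a * √(B.info (fun ℓ => I ℓ ω) t j) * z)
      ∂(gaussianReal 0 1) ∂P := by
  have htn : t ≤ n + 1 := by have := (Finset.mem_Ioc.1 ht).2; omega
  let S : (Finset.Ico 1 t → Fin K × ℝ) → (Finset.Ico 1 t → ℝ) → ℝ := fun h z =>
    ∑ ℓ, B.x (h ℓ).1 j * z ℓ
  have hS : Measurable fun p : (Finset.Ico 1 t → ℝ) × (Finset.Ico 1 t → Fin K × ℝ) =>
      S p.2 p.1 := by
    refine Finset.measurable_sum _ fun ℓ _ => Measurable.mul ?_ (by fun_prop)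
    exact (Measurable.of_discrete (f := fun i => B.x i j)).comp (by fun_prop)
  have hZm : Measurable fun ω (ℓ : Finset.Ico 1 t) => Z t ℓ ω :=
    measurable_pi_lambda _ fun ℓ => H.measurable_Z t ht ℓ ℓ.2
  have hHm := H.measurable_history htn
  have hscore : ∀ ω, B.score (fun ℓ => I ℓ ω) (fun ℓ => Z t ℓ ω) t j =
      S (history Y I t ω) (fun ℓ => Z t ℓ ω) := fun ω =>
    (Finset.sum_coe_sort (Finset.Ico 1 t) fun ℓ => B.x (I ℓ ω) j * Z t ℓ ω).symm
  have hmap := (indepFun_iff_map_prod_eq_prod_map_map hZm.aemeasurable hHm.aemeasurable).1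
    (H.indep_Z t ht)
  have hG : Measurable fun p : (Finset.Ico 1 t → ℝ) × (Finset.Ico 1 t → Fin K × ℝ) =>
      F (p.2, S p.2 p.1) := hF.comp (measurable_snd.prodMk hS)
  have : IsProbabilityMeasure (P.map fun ω (ℓ : Finset.Ico 1 t) => Z t ℓ ω) :=
    Measure.isProbabilityMeasure_map hZm.aemeasurable
  have : IsProbabilityMeasure (P.map (history Y I t)) :=
    Measure.isProbabilityMeasure_map hHm.aemeasurable
  -- With the history frozen, the score is a linear combination of independent Gaussians with
  -- constant coefficients, of variance a² g_j.
  have hinner : ∀ h, ∫⁻ z, F (h, S h z) ∂(P.map fun ω (ℓ : Finset.Ico 1 t) => Z t ℓ ω) =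
      ∫⁻ z, F (h, a * √(B.info (B.pastArm h) t j) * z) ∂(gaussianReal 0 1) := by
    intro h
    have hSh : Measurable (S h) := hS.comp (measurable_id.prodMk measurable_const)
    have hFh : Measurable fun s => F (h, s) := hF.comp (measurable_const.prodMk measurable_id)
    have hlaw := map_sum_gaussianReal (X := fun (ℓ : Finset.Ico 1 t) => Z t ℓ)
      (fun ℓ => H.measurable_Z t ht ℓ ℓ.2) (fun ℓ => H.law_Z t ht ℓ ℓ.2) (H.iIndep_Z t ht)
      (fun ℓ => B.x (h ℓ).1 j)
    have hinfo : ∑ ℓ, B.x (h ℓ).1 j ^ 2 = B.info (B.pastArm h) t j := by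
      refine Eq.trans ?_ (Finset.sum_coe_sort (Finset.Ico 1 t) fun ℓ =>
        B.x (B.pastArm h ℓ) j ^ 2)
      refine Finset.sum_congr rfl fun ℓ _ => ?_
      rw [pastArm, dif_pos ℓ.2]
    rw [hinfo, ← Real.toNNReal_mul (B.info_nonneg _ _ _),
      show B.info (B.pastArm h) t j * a ^ 2 = (a * √(B.info (B.pastArm h) t j)) ^ 2 by
        rw [mul_pow, Real.sq_sqrt (B.info_nonneg _ _ _), mul_comm],
      gaussianReal_eq_map_standard] at hlaw
    rw [← lintegral_map (g := fun z => a * √(B.info (B.pastArm h) t j) * z) hFh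
      (measurable_const_mul _), ← hlaw, lintegral_map (f := fun z => F (h, S h z)) (hFh.comp hSh) hZm]
    exact (lintegral_map hFh (hSh.comp hZm)).symm
  calc ∫⁻ ω, F (history Y I t ω, B.score (fun ℓ => I ℓ ω) (fun ℓ => Z t ℓ ω) t j) ∂P
      = ∫⁻ p, F (p.2, S p.2 p.1) ∂(P.map fun ω =>
          ((fun (ℓ : Finset.Ico 1 t) => Z t ℓ ω), history Y I t ω)) := by
        rw [lintegral_map hG (hZm.prodMk hHm)]
        exact lintegral_congr fun ω => by rw [hscore]
    _ = ∫⁻ h, ∫⁻ z, F (h, S h z) ∂(P.map fun ω (ℓ : Finset.Ico 1 t) => Z t ℓ ω)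
          ∂(P.map (history Y I t)) := by
        rw [hmap, lintegral_prod_symm _ hG.aemeasurable]
    _ = ∫⁻ h, ∫⁻ z, F (h, a * √(B.info (B.pastArm h) t j) * z) ∂(gaussianReal 0 1)
          ∂(P.map (history Y I t)) := lintegral_congr hinner
    _ = _ := by
        rw [lintegral_map _ hHm]
        · exact lintegral_congr fun ω => by rw [B.info_congr (B.pastArm_history ω) j]
        · simp_rw [← hinner]
          exact Measurable.lintegral_prod_left' hG

end IsGLMFPL

end GLMBandit

/-- The value of the Gaussian mixture of the exponential supermartingale. -/
noncomputable def mixture (σ g N : ℝ) : ℝ :=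
  Real.exp (N ^ 2 / (σ ^ 2 * (2 * g + 1))) / √(1 + 2 * g)

lemma mixture_nonneg (σ g N : ℝ) : 0 ≤ mixture σ g N := by unfold mixture; positivity

/-- Measuring the noise in units of its confidence width σ√L√g brings the mixture to the form of the
numerical inequalities. -/
lemma mixVal_eq_mixture {σ g L : ℝ} (hσ : 0 < σ) (hg : 0 < g) (hL : 0 < L) (N : ℝ) :
    mixVal L g (|N| / (σ * √L * √g)) = mixture σ g N := by
  unfold mixVal mixture
  congr 2
  rw [div_pow, mul_pow, mul_pow, Real.sq_sqrt hL.le, Real.sq_sqrt hg.le, sq_abs]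
  field_simp

/-! ### Bad and optimistic perturbations -/

namespace GLMBandit

variable {d K : ℕ} (B : GLMBandit d K)

/-- The radius of the confidence interval of the perturbed estimate. -/
noncomputable def radius (c₁ : ℝ) (n : ℕ) : ℝ :=
  c₁ * (1 + B.slopeMin⁻¹ * B.slopeMax * √(2 * Real.log (d * n)))

section Perturbation

variable {n : ℕ} {c₁ a g N : ℝ} (hb : BddAbove B.slopes) (hn : 7 ≤ n) (hd : 1 ≤ d)
  (hc₁ : c₁ = B.σ * B.slopeMin⁻¹ * √(confWidth d n)) (ha : a = c₁ * B.slopeMax)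
include hb hn hd hc₁

omit hb in
lemma c₁_pos (hdn : d < n) : 0 < c₁ := by
  rw [hc₁]
  have := B.σ_pos
  have := B.slopeMin_pos
  have := confWidth_pos hd hdn hn
  positivity

lemma radius_nonneg (hdn : d < n) : 0 ≤ B.radius c₁ n := by
  have := B.c₁_pos hn hd hc₁ hdn
  have := B.slopeMin_pos
  have := B.slopeMax_pos hb
  unfold radius
  positivity

include ha

lemma perturbation_scale_pos (hdn : d < n) : 0 < a := by
  rw [ha]
  exact mul_pos (B.c₁_pos hn hd hc₁ hdn) (B.slopeMax_pos hb)

omit hb hn hd in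
lemma slopeMin_mul_radius :
    B.slopeMin * B.radius c₁ n = B.σ * √(confWidth d n) + a * √(2 * Real.log (d * n)) := by
  have := B.slopeMin_pos.ne'
  rw [ha, radius, hc₁]
  field_simp

omit hn hd in
lemma noise_scale_le : B.σ * √(confWidth d n) ≤ a := by
  have h1 := B.slopeMin_pos
  have h2 := B.slopeMin_le_slopeMax hb
  have h3 := B.σ_pos
  have e : a = B.σ * √(confWidth d n) * (B.slopeMin⁻¹ * B.slopeMax) := by rw [ha, hc₁]; ring
  rw [e]
  refine le_mul_of_one_le_right (by positivity) ?_
  rw [inv_mul_eq_div, one_le_div h1]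
  exact h2

/-- A perturbed noise leaves the confidence interval with a small probability. -/
lemma gaussianReal_bad_le (hdn : d + 2 ≤ n) (hg : 1 ≤ g) (hgm : g ≤ (n : ℝ) - d) :
    gaussianReal 0 1 {z | B.slopeMin * B.radius c₁ n * √g < |N + a * √g * z|} ≤
      ENNReal.ofReal (1 / (d * n) * (1 + 2 / ((n : ℝ) - d + 1) * mixture B.σ g N)) := by
  have hdn' : d < n := by omega
  have ha0 := B.perturbation_scale_pos hb hn hd hc₁ ha hdn'
  have hL := confWidth_pos hd hdn' hn
  have hσ := B.σ_pos
  have hκ := B.noise_scale_le hb hc₁ ha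
  have hd' : (1 : ℝ) ≤ d := by exact_mod_cast hd
  have hn' : (7 : ℝ) ≤ n := by exact_mod_cast hn
  have hsL : 0 < B.σ * √(confWidth d n) := by positivity
  set s := √(2 * Real.log (d * n)) with hs
  -- y is the noise in units of its confidence width, κ the ratio of the perturbation scale to the
  -- noise scale. A bad event forces |z| past s + (1 - y)/κ.
  set y := |N| / (B.σ * √(confWidth d n) * √g) with hy
  set κ := a / (B.σ * √(confWidth d n)) with hκdef
  have hκ1 : 1 ≤ κ := (one_le_div hsL).2 hκ
  have hg0 : 0 < √g := Real.sqrt_pos.2 (by linarith)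
  have hsub : {z | B.slopeMin * B.radius c₁ n * √g < |N + a * √g * z|} ⊆
      {z | s + (1 - y) / κ < |z|} := by
    intro z hz
    have hz1 : B.slopeMin * B.radius c₁ n * √g < |N + a * √g * z| := hz
    have hz2 : |N + a * √g * z| ≤ |N| + a * √g * |z| := by
      refine (abs_add_le _ _).trans (le_of_eq ?_)
      rw [abs_mul, abs_of_pos (mul_pos ha0 hg0)]
    rw [B.slopeMin_mul_radius hc₁ ha, ← hs] at hz1
    have hN : |N| = y * (B.σ * √(confWidth d n) * √g) := by rw [hy]; field_simp
    have e : (1 - y) / κ = (1 - y) * (B.σ * √(confWidth d n)) / a := by rw [hκdef]; field_simp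
    have hlt := hz1.trans_le hz2
    rw [hN] at hlt
    show s + (1 - y) / κ < |z|
    rw [e]
    have h3 : (B.σ * √(confWidth d n) + a * s) < y * (B.σ * √(confWidth d n)) + a * |z| := by
      refine lt_of_mul_lt_mul_right ?_ hg0.le
      linarith
    have h4 : a * (s + (1 - y) * (B.σ * √(confWidth d n)) / a) < a * |z| := by
      rw [mul_add, mul_div_cancel₀ _ ha0.ne']
      linarith
    exact lt_of_mul_lt_mul_left h4 ha0.le
  refine (measure_mono hsub).trans ((gaussianReal_abs_gt_le _
    (Real.sqrt_nonneg (2 * Real.log (d * n)))).trans ?_)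
  refine ENNReal.ofReal_le_ofReal ?_
  refine (exp_tail_le hg hgm (three_mul_log_le_confWidth hd hdn') (Real.sqrt_nonneg _)
    (sqrt_two_log_mul_le_confWidth hd hdn hn) hκ1).trans (le_of_eq ?_)
  rw [mixVal_eq_mixture hσ (by linarith) hL]
  congr 1
  -- The choice s² = 2 log(dn) makes exp(-s²/2) equal to 1/(dn).
  have h1 : 1 ≤ (d : ℝ) * n := by nlinarith
  rw [Real.sq_sqrt (by have := Real.log_nonneg h1; positivity), neg_div, mul_div_cancel_left₀ _
    two_ne_zero, Real.exp_neg, Real.exp_log (by linarith), one_div]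

omit hb ha hn hc₁ in
-- Markov's inequality in disguise: since the mixture has mean at most one, large noise has
-- probability at most 2 / (n - d + 1).
lemma one_le_mixture (hdn : d < n) (hn : 7 ≤ n) (hg : 1 ≤ g) (hgm : g ≤ (n : ℝ) - d)
    (hN : B.σ * √(confWidth d n) * √g < |N|) :
    1 ≤ 2 / ((n : ℝ) - d + 1) * mixture B.σ g N := by
  have hL := confWidth_pos hd hdn hn
  have hσ := B.σ_pos
  rw [← mixVal_eq_mixture hσ (by linarith) hL]
  refine one_le_mul_mixVal hg hgm (three_mul_log_le_confWidth hd hdn) ?_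
  have hg0 : 0 < √g := Real.sqrt_pos.2 (by linarith)
  refine one_le_pow₀ ?_
  rw [one_le_div (by positivity)]
  exact hN.le

end Perturbation

namespace IsGLMFPL

variable {B} {Ω : Type*} [MeasurableSpace Ω] {P : Measure Ω} [IsProbabilityMeasure P]
  {n τ : ℕ} {a : ℝ} {Y : Fin K → ℕ → Ω → ℝ} {Z : ℕ → ℕ → Ω → ℝ}
  {θ' : ℕ → Ω → EuclideanSpace ℝ (Fin d)} {I : ℕ → Ω → Fin K}
  (H : B.IsGLMFPL P n τ a Y Z θ' I) {t : ℕ} (ht : t ∈ Finset.Ioc τ n)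
  {f : (Finset.Ico 1 t → Fin K × ℝ) → ℝ} (hf : Measurable f)
  (hf0 : ∀ h, 0 ≤ f h) (hf1 : ∀ h, f h ≤ 1)
include H

omit [IsProbabilityMeasure P] in
lemma measurable_score (ht : t ∈ Finset.Ioc τ n) (j : Fin d) :
    Measurable fun ω => B.score (fun ℓ => I ℓ ω) (fun ℓ => Z t ℓ ω) t j := by
  unfold score
  refine Finset.measurable_fun_sum _ fun ℓ hℓ => Measurable.fun_mul ?_ (H.measurable_Z t ht ℓ hℓ)
  refine (Measurable.of_discrete (f := fun i => B.x i j)).comp (H.measurable_I ℓ ?_)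
  have h1 := Finset.mem_Ico.1 hℓ
  have h2 := Finset.mem_Ioc.1 ht
  exact Finset.mem_Icc.2 ⟨h1.1, by omega⟩

omit H in
/-- The rounds in which the perturbed noise of a coordinate leaves the confidence interval. -/
def bad (B : GLMBandit d K) (C : ℝ) (Y : Fin K → ℕ → Ω → ℝ) (Z : ℕ → ℕ → Ω → ℝ)
    (I : ℕ → Ω → Fin K) (t : ℕ) (j : Fin d) : Set Ω :=
  {ω | B.slopeMin * C * √(B.info (fun ℓ => I ℓ ω) t j) <
    |B.noise (fun ℓ => I ℓ ω) (fun ℓ => Y (I ℓ ω) ℓ ω) t j +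
      B.score (fun ℓ => I ℓ ω) (fun ℓ => Z t ℓ ω) t j|}

omit H in
/-- The rounds in which the perturbation of a coordinate is optimistic in the direction `v`. -/
def optimistic (B : GLMBandit d K) (a v : ℝ) (Z : ℕ → ℕ → Ω → ℝ)
    (I : ℕ → Ω → Fin K) (t : ℕ) (j : Fin d) : Set Ω :=
  {ω | a * √(B.info (fun ℓ => I ℓ ω) t j) ≤
    v * B.score (fun ℓ => I ℓ ω) (fun ℓ => Z t ℓ ω) t j}

omit [IsProbabilityMeasure P] in
lemma measurableSet_bad (C : ℝ) (ht : t ∈ Finset.Ioc τ n) (j : Fin d) :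
    MeasurableSet (bad B C Y Z I t j) := by
  have htn : t ≤ n + 1 := by have := (Finset.mem_Ioc.1 ht).2; omega
  exact measurableSet_lt ((Real.continuous_sqrt.measurable.comp
    (H.measurable_info htn j)).const_mul _)
    (((H.measurable_noise htn j).fun_add (H.measurable_score ht j)).abs)

omit [IsProbabilityMeasure P] in
lemma measurableSet_optimistic (v : ℝ) (ht : t ∈ Finset.Ioc τ n) (j : Fin d) :
    MeasurableSet (optimistic B a v Z I t j) := by
  have htn : t ≤ n + 1 := by have := (Finset.mem_Ioc.1 ht).2; omega
  exact measurableSet_le ((Real.continuous_sqrt.measurable.comp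
    (H.measurable_info htn j)).const_mul _) ((H.measurable_score ht j).const_mul v)

include ht hf in
-- The weight f depends on the history only, so it factors out of the conditional probability. It is
-- later taken to be the minimal width as well as 1.
lemma lintegral_indicator_bad_le (C : ℝ) (j : Fin d) {q : Ω → ENNReal}
    (hq : ∀ᵐ ω ∂P, gaussianReal 0 1 {z | B.slopeMin * C * √(B.info (fun ℓ => I ℓ ω) t j) <
      |B.noise (fun ℓ => I ℓ ω) (fun ℓ => Y (I ℓ ω) ℓ ω) t j +
        a * √(B.info (fun ℓ => I ℓ ω) t j) * z|} ≤ q ω) :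
    ∫⁻ ω, (bad B C Y Z I t j).indicator
      (fun ω => ENNReal.ofReal (f (history Y I t ω))) ω ∂P ≤
    ∫⁻ ω, ENNReal.ofReal (f (history Y I t ω)) * q ω ∂P := by
  let T : Set ((Finset.Ico 1 t → Fin K × ℝ) × ℝ) :=
    {p | B.slopeMin * C * √(B.info (B.pastArm p.1) t j) <
      |B.noise (B.pastArm p.1) (pastReward p.1) t j + p.2|}
  have hm1 : Measurable fun p : (Finset.Ico 1 t → Fin K × ℝ) × ℝ => B.info (B.pastArm p.1) t j :=
    (B.measurable_info_past t j).comp measurable_fst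
  have hm2 : Measurable fun p : (Finset.Ico 1 t → Fin K × ℝ) × ℝ =>
      B.noise (B.pastArm p.1) (pastReward p.1) t j :=
    (B.measurable_noise_past t j).comp measurable_fst
  have hT : MeasurableSet T :=
    measurableSet_lt ((Real.continuous_sqrt.measurable.comp hm1).const_mul _)
      (hm2.fun_add measurable_snd).abs
  have hF : Measurable (T.indicator fun p => ENNReal.ofReal (f p.1)) :=
    (hf.comp measurable_fst).ennreal_ofReal.indicator hT
  have hmem : ∀ ω w, ((history Y I t ω, w) ∈ T ↔
      B.slopeMin * C * √(B.info (fun ℓ => I ℓ ω) t j) <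
        |B.noise (fun ℓ => I ℓ ω) (fun ℓ => Y (I ℓ ω) ℓ ω) t j + w|) := by
    intro ω w
    rw [B.info_congr (B.pastArm_history (Y := Y) ω) j,
      B.noise_congr (B.pastArm_history ω) (pastReward_history ω) j]
    rfl
  have key := H.lintegral_perturbation ht j hF
  have hleft : ∀ ω, T.indicator (fun p => ENNReal.ofReal (f p.1))
      (history Y I t ω, B.score (fun ℓ => I ℓ ω) (fun ℓ => Z t ℓ ω) t j) =
      (bad B C Y Z I t j).indicator (fun ω => ENNReal.ofReal (f (history Y I t ω))) ω := by
    intro ω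
    by_cases h : ω ∈ bad B C Y Z I t j
    · rw [Set.indicator_of_mem h, Set.indicator_of_mem ((hmem _ _).2 h)]
    · rw [Set.indicator_of_notMem h, Set.indicator_of_notMem fun hc => h ((hmem _ _).1 hc)]
  simp_rw [← hleft]
  rw [key]
  refine lintegral_mono_ae ?_
  filter_upwards [hq] with ω hω
  refine le_trans (le_of_eq ?_) (mul_le_mul_right hω _)
  rw [← setLIntegral_const, ← lintegral_indicator]
  · refine lintegral_congr fun z => ?_
    by_cases h : (history Y I t ω, a * √(B.info (fun ℓ => I ℓ ω) t j) * z) ∈ T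
    · rw [Set.indicator_of_mem h, Set.indicator_of_mem (by exact (hmem _ _).1 h)]
    · rw [Set.indicator_of_notMem h]
      refine (Set.indicator_of_notMem ?_ _).symm
      exact fun hc => h ((hmem _ _).2 hc)
  · exact measurableSet_lt measurable_const (by fun_prop)

include ht hf in
-- Given the history, the event says that a standard Gaussian, multiplied by v, is at least 1. The
-- sign v lets optimism follow the sign of the feature of the best arm.
lemma le_lintegral_indicator_optimistic (ha : 0 < a) {v : ℝ} (hv : v = 1 ∨ v = -1) (j : Fin d)
    (hinfo : ∀ᵐ ω ∂P, 0 < B.info (fun ℓ => I ℓ ω) t j) :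
    ENNReal.ofReal 0.15 * ∫⁻ ω, ENNReal.ofReal (f (history Y I t ω)) ∂P ≤
    ∫⁻ ω, (optimistic B a v Z I t j).indicator
      (fun ω => ENNReal.ofReal (f (history Y I t ω))) ω ∂P := by
  let T : Set ((Finset.Ico 1 t → Fin K × ℝ) × ℝ) :=
    {p | a * √(B.info (B.pastArm p.1) t j) ≤ v * p.2}
  have hm1 : Measurable fun p : (Finset.Ico 1 t → Fin K × ℝ) × ℝ => B.info (B.pastArm p.1) t j :=
    (B.measurable_info_past t j).comp measurable_fst
  have hT : MeasurableSet T :=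
    measurableSet_le ((Real.continuous_sqrt.measurable.comp hm1).const_mul _)
      (measurable_snd.const_mul v)
  have hF : Measurable (T.indicator fun p => ENNReal.ofReal (f p.1)) :=
    (hf.comp measurable_fst).ennreal_ofReal.indicator hT
  have hmem : ∀ ω w, ((history Y I t ω, w) ∈ T ↔
      a * √(B.info (fun ℓ => I ℓ ω) t j) ≤ v * w) := by
    intro ω w
    rw [B.info_congr (B.pastArm_history (Y := Y) ω) j]
    rfl
  have key := H.lintegral_perturbation ht j hF
  have hleft : ∀ ω, T.indicator (fun p => ENNReal.ofReal (f p.1))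
      (history Y I t ω, B.score (fun ℓ => I ℓ ω) (fun ℓ => Z t ℓ ω) t j) =
      (optimistic B a v Z I t j).indicator
        (fun ω => ENNReal.ofReal (f (history Y I t ω))) ω := by
    intro ω
    by_cases h : ω ∈ optimistic B a v Z I t j
    · rw [Set.indicator_of_mem h, Set.indicator_of_mem ((hmem _ _).2 h)]
    · rw [Set.indicator_of_notMem h, Set.indicator_of_notMem fun hc => h ((hmem _ _).1 hc)]
  simp_rw [← hleft]
  have htn : t ≤ n + 1 := by have := (Finset.mem_Ioc.1 ht).2; omega
  have hfm : Measurable fun ω => ENNReal.ofReal (f (history Y I t ω)) :=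
    (hf.comp (H.measurable_history htn)).ennreal_ofReal
  rw [key, ← lintegral_const_mul _ hfm]
  refine lintegral_mono_ae ?_
  filter_upwards [hinfo] with ω hω
  have hγ : ENNReal.ofReal 0.15 ≤ gaussianReal 0 1 {z : ℝ | 1 ≤ v * z} := by
    rcases hv with rfl | rfl
    · refine gaussianReal_Ici_one_ge.trans (measure_mono fun z hz => ?_)
      simpa using hz
    · refine gaussianReal_Iic_neg_one_ge.trans (measure_mono fun z hz => ?_)
      have : z ≤ -1 := hz
      show 1 ≤ -1 * z
      linarith
  rw [mul_comm]
  refine (mul_le_mul_right hγ _).trans ?_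
  rw [← setLIntegral_const, ← lintegral_indicator]
  · refine lintegral_mono fun z => ?_
    by_cases h : z ∈ {z : ℝ | 1 ≤ v * z}
    · rw [Set.indicator_of_mem h, Set.indicator_of_mem]
      rw [hmem]
      have h2 : 1 ≤ v * z := h
      have h3 : 0 < a * √(B.info (fun ℓ => I ℓ ω) t j) := mul_pos ha (Real.sqrt_pos.2 hω)
      nlinarith
    · rw [Set.indicator_of_notMem h]
      exact zero_le
  · exact measurableSet_le measurable_const (by fun_prop)

end IsGLMFPL

end GLMBandit

/-! ### Expected regret of a single round -/

namespace GLMBandit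

variable {d K : ℕ} (B : GLMBandit d K)

lemma score_add (arm : ℕ → Fin K) (y z : ℕ → ℝ) (t : ℕ) (j : Fin d) :
    B.score arm (fun ℓ => y ℓ + z ℓ - B.mean ⟪B.x (arm ℓ), B.θstar⟫) t j =
      B.noise arm y t j + B.score arm z t j := by
  unfold noise score
  rw [← Finset.sum_add_distrib]
  exact Finset.sum_congr rfl fun ℓ _ => by ring

/-- Since slopeMax / slopeMin ≥ 1, it can be factored out of the radius; then 1 + √(2 log(dn)) ≤ √(8
log n) explains the constant 8. This keeps every coordinate of an accurate estimate within distance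
one of `θstar`. -/
lemma radius_le_sqrt {n : ℕ} {c₁ a g : ℝ} (hb : BddAbove B.slopes) (hn : 7 ≤ n) (hd : 1 ≤ d)
    (hc₁ : c₁ = B.σ * B.slopeMin⁻¹ * √(confWidth d n)) (ha : a = c₁ * B.slopeMax)
    (hdn : d < n) (hg : 8 * a ^ 2 * (B.slopeMin ^ 2)⁻¹ * Real.log n ≤ g) :
    B.radius c₁ n ≤ √g := by
  have h1 := B.slopeMin_pos
  have h2 := B.slopeMin_le_slopeMax hb
  have h3 := B.c₁_pos hn hd hc₁ hdn
  have hl := log_seven_le hn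
  have hs := one_add_sqrt_two_log_mul_le hd hdn hn
  have hκ : 1 ≤ B.slopeMin⁻¹ * B.slopeMax := by rwa [inv_mul_eq_div, one_le_div h1]
  refine Real.le_sqrt_of_sq_le (le_trans ?_ hg)
  have hle : B.radius c₁ n ≤ c₁ * (B.slopeMin⁻¹ * B.slopeMax * √(8 * Real.log n)) := by
    unfold radius
    refine mul_le_mul_of_nonneg_left ?_ h3.le
    have h4 := mul_le_mul_of_nonneg_left hs (show 0 ≤ B.slopeMin⁻¹ * B.slopeMax by linarith)
    linarith
  refine (pow_le_pow_left₀ (B.radius_nonneg hb hn hd hc₁ hdn) hle 2).trans (le_of_eq ?_)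
  rw [mul_pow, mul_pow, Real.sq_sqrt (by linarith), ha]
  field_simp

lemma OneSparse.exists_coord {B : GLMBandit d K} (hs : B.OneSparse) (hd : 1 ≤ d) (i : Fin K) :
    ∃ j, ∀ θ : EuclideanSpace ℝ (Fin d), ⟪B.x i, θ⟫ = B.x i j * θ j := by
  by_cases h : ∃ j, B.x i j ≠ 0
  · obtain ⟨j, hj⟩ := h
    exact ⟨j, fun θ => hs.inner_eq hj θ⟩
  · push Not at h
    refine ⟨⟨0, hd⟩, fun θ => ?_⟩
    rw [PiLp.inner_apply]
    simp [h]

namespace IsGLMFPL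

variable {B} {Ω : Type*} [MeasurableSpace Ω] {P : Measure Ω} [IsProbabilityMeasure P]
  {n τ : ℕ} {a c₁ : ℝ} {Y : Fin K → ℕ → Ω → ℝ} {Z : ℕ → ℕ → Ω → ℝ}
  {θ' : ℕ → Ω → EuclideanSpace ℝ (Fin d)} {I : ℕ → Ω → Fin K}
  (H : B.IsGLMFPL P n τ a Y Z θ' I) {t : ℕ} (ht : t ∈ Finset.Ioc τ n)

section Real

variable {f : (Finset.Ico 1 t → Fin K × ℝ) → ℝ} (hf : Measurable f)
  (hf0 : ∀ h, 0 ≤ f h) (hf1 : ∀ h, f h ≤ 1)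
include H ht hf hf0 hf1

lemma integrable_history : Integrable (fun ω => f (history Y I t ω)) P := by
  have htn : t ≤ n + 1 := by have := (Finset.mem_Ioc.1 ht).2; omega
  refine Integrable.of_bound (hf.comp (H.measurable_history htn)).aestronglyMeasurable 1 ?_
  refine Filter.Eventually.of_forall fun ω => ?_
  rw [Real.norm_eq_abs, abs_of_nonneg (hf0 _)]
  exact hf1 _

lemma ofReal_integral_indicator {S : Set Ω} (hS : MeasurableSet S) :
    ENNReal.ofReal (∫ ω, S.indicator (fun ω => f (history Y I t ω)) ω ∂P) =
      ∫⁻ ω, S.indicator (fun ω => ENNReal.ofReal (f (history Y I t ω))) ω ∂P := by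
  rw [ofReal_integral_eq_lintegral_ofReal ((H.integrable_history ht hf hf0 hf1).indicator hS)
    (Filter.Eventually.of_forall fun ω => Set.indicator_nonneg (fun ω _ => hf0 _) ω)]
  refine lintegral_congr fun ω => ?_
  by_cases h : ω ∈ S <;> simp [h]

lemma integral_indicator_optimistic_ge (ha : 0 < a) {v : ℝ} (hv : v = 1 ∨ v = -1) (j : Fin d)
    (hinfo : ∀ᵐ ω ∂P, 0 < B.info (fun ℓ => I ℓ ω) t j) :
    0.15 * ∫ ω, f (history Y I t ω) ∂P ≤
      ∫ ω, (optimistic B a v Z I t j).indicator (fun ω => f (history Y I t ω)) ω ∂P := by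
  have h := H.le_lintegral_indicator_optimistic ht hf ha hv j hinfo
  rw [← H.ofReal_integral_indicator ht hf hf0 hf1 (H.measurableSet_optimistic v ht j),
    ← ofReal_integral_eq_lintegral_ofReal (H.integrable_history ht hf hf0 hf1)
      (Filter.Eventually.of_forall fun ω => hf0 _), ← ENNReal.ofReal_mul (by norm_num)] at h
  refine (ENNReal.ofReal_le_ofReal_iff ?_).1 h
  exact integral_nonneg fun ω => Set.indicator_nonneg (fun ω _ => hf0 _) ω

/-- The weight f is kept on the leading term, so that it can be absorbed later, and bounded by 1 on
the mixture term. The union over d coordinates turns 1/(dn) into 1/n. -/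
lemma integral_indicator_bad_le (hb : BddAbove B.slopes) (hn : 7 ≤ n) (hd : 1 ≤ d)
    (hc₁ : c₁ = B.σ * B.slopeMin⁻¹ * √(confWidth d n)) (ha : a = c₁ * B.slopeMax)
    (hdn : d + 2 ≤ n)
    (hinfo : ∀ᵐ ω ∂P, ∀ j, 1 ≤ B.info (fun ℓ => I ℓ ω) t j ∧
      B.info (fun ℓ => I ℓ ω) t j ≤ (n : ℝ) - d) :
    ∫ ω, (⋃ j, bad B (B.radius c₁ n) Y Z I t j).indicator
      (fun ω => f (history Y I t ω)) ω ∂P ≤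
      1 / n * (∫ ω, f (history Y I t ω) ∂P) + 2 / (((n : ℝ) - d + 1) * n) := by
  have htn : t ≤ n + 1 := by have := (Finset.mem_Ioc.1 ht).2; omega
  have hd' : (1 : ℝ) ≤ d := by exact_mod_cast hd
  have hdn' : (d : ℝ) + 2 ≤ n := by exact_mod_cast hdn
  have hS : MeasurableSet (⋃ j, bad B (B.radius c₁ n) Y Z I t j) :=
    MeasurableSet.iUnion fun j => H.measurableSet_bad _ ht j
  have hU0 : 0 ≤ ∫ ω, f (history Y I t ω) ∂P := integral_nonneg fun ω => hf0 _
  set p : ℝ := 1 / (d * n) with hp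
  set α : ℝ := 2 / ((n : ℝ) - d + 1) with hα
  have hp0 : 0 ≤ p := by positivity
  have hα0 : 0 ≤ α := div_nonneg zero_le_two (by linarith)
  have hfm : Measurable fun ω => ENNReal.ofReal (f (history Y I t ω)) :=
    (hf.comp (H.measurable_history htn)).ennreal_ofReal
  have hj : ∀ j, ∫⁻ ω, (bad B (B.radius c₁ n) Y Z I t j).indicator
      (fun ω => ENNReal.ofReal (f (history Y I t ω))) ω ∂P ≤
      ENNReal.ofReal (p * (∫ ω, f (history Y I t ω) ∂P) + p * α) := by
    intro j
    set M : Ω → ℝ := fun ω => mixture B.σ (B.info (fun ℓ => I ℓ ω) t j)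
      (B.noise (fun ℓ => I ℓ ω) (fun ℓ => Y (I ℓ ω) ℓ ω) t j) with hM
    have hM0 : ∀ ω, 0 ≤ M ω := fun ω => mixture_nonneg _ _ _
    have hMint : ∫⁻ ω, ENNReal.ofReal (M ω) ∂P ≤ 1 := H.lintegral_mixture_le j htn
    refine (H.lintegral_indicator_bad_le ht hf (B.radius c₁ n) j
      (q := fun ω => ENNReal.ofReal (p * (1 + α * M ω))) ?_).trans ?_
    · filter_upwards [hinfo] with ω hω
      exact B.gaussianReal_bad_le hb hn hd hc₁ ha hdn (hω j).1 (hω j).2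
    · calc ∫⁻ ω, ENNReal.ofReal (f (history Y I t ω)) * ENNReal.ofReal (p * (1 + α * M ω)) ∂P
          ≤ ∫⁻ ω, (ENNReal.ofReal p * ENNReal.ofReal (f (history Y I t ω)) +
              ENNReal.ofReal (p * α) * ENNReal.ofReal (M ω)) ∂P := by
            refine lintegral_mono fun ω => ?_
            beta_reduce
            rw [← ENNReal.ofReal_mul (hf0 _), ← ENNReal.ofReal_mul hp0,
              ← ENNReal.ofReal_mul (by positivity),
              ← ENNReal.ofReal_add (mul_nonneg hp0 (hf0 _)) (mul_nonneg (by positivity) (hM0 ω))]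
            refine ENNReal.ofReal_le_ofReal ?_
            have h1 : 0 ≤ p * α * M ω := mul_nonneg (by positivity) (hM0 ω)
            nlinarith [mul_le_mul_of_nonneg_left (hf1 (history Y I t ω)) h1]
        _ = ENNReal.ofReal p * ∫⁻ ω, ENNReal.ofReal (f (history Y I t ω)) ∂P +
              ENNReal.ofReal (p * α) * ∫⁻ ω, ENNReal.ofReal (M ω) ∂P := by
            rw [lintegral_add_left (hfm.const_mul _), lintegral_const_mul _ hfm,
              lintegral_const_mul' _ _ ENNReal.ofReal_ne_top]
        _ ≤ ENNReal.ofReal p * ENNReal.ofReal (∫ ω, f (history Y I t ω) ∂P) +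
              ENNReal.ofReal (p * α) * 1 := by
            rw [ofReal_integral_eq_lintegral_ofReal (H.integrable_history ht hf hf0 hf1)
              (Filter.Eventually.of_forall fun ω => hf0 _)]
            gcongr
        _ = _ := by
            rw [mul_one, ← ENNReal.ofReal_mul hp0,
              ← ENNReal.ofReal_add (by positivity) (by positivity)]
  have htot : ENNReal.ofReal (∫ ω, (⋃ j, bad B (B.radius c₁ n) Y Z I t j).indicator
      (fun ω => f (history Y I t ω)) ω ∂P) ≤
      ENNReal.ofReal (d * (p * (∫ ω, f (history Y I t ω) ∂P) + p * α)) := by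
    rw [H.ofReal_integral_indicator ht hf hf0 hf1 hS]
    calc _ ≤ ∫⁻ ω, ∑ j, (bad B (B.radius c₁ n) Y Z I t j).indicator
          (fun ω => ENNReal.ofReal (f (history Y I t ω))) ω ∂P := by
          refine lintegral_mono fun ω => ?_
          by_cases h : ω ∈ ⋃ j, bad B (B.radius c₁ n) Y Z I t j
          · obtain ⟨j, hj⟩ := Set.mem_iUnion.1 h
            rw [Set.indicator_of_mem h]
            refine le_trans (le_of_eq ?_) (Finset.single_le_sum
              (f := fun j => (bad B (B.radius c₁ n) Y Z I t j).indicator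
                (fun ω => ENNReal.ofReal (f (history Y I t ω))) ω)
              (fun _ _ => zero_le) (Finset.mem_univ j))
            beta_reduce
            rw [Set.indicator_of_mem hj]
          · rw [Set.indicator_of_notMem h]
            exact zero_le
      _ = ∑ j, ∫⁻ ω, (bad B (B.radius c₁ n) Y Z I t j).indicator
          (fun ω => ENNReal.ofReal (f (history Y I t ω))) ω ∂P :=
          lintegral_finsetSum _ fun j _ => hfm.indicator (H.measurableSet_bad _ ht j)
      _ ≤ ∑ _j : Fin d, ENNReal.ofReal (p * (∫ ω, f (history Y I t ω) ∂P) + p * α) :=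
          Finset.sum_le_sum fun j _ => hj j
      _ = _ := by
          rw [Finset.sum_const, Finset.card_univ, Fintype.card_fin, nsmul_eq_mul,
            ENNReal.ofReal_mul (Nat.cast_nonneg _), ENNReal.ofReal_natCast]
  refine ((ENNReal.ofReal_le_ofReal_iff (by positivity)).1 htot).trans (le_of_eq ?_)
  rw [hp, hα]
  have h1 : (n : ℝ) - d + 1 ≠ 0 := by linarith
  field_simp

end Real

section Integrable

include H

omit [IsProbabilityMeasure P] in
lemma measurable_width (ht : t ∈ Finset.Ioc τ n) :
    Measurable fun ω => B.width (fun ℓ => I ℓ ω) t (I t ω) := by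
  have htn := Finset.mem_Ioc.1 ht
  have h1 : Measurable fun p : (Finset.Ico 1 t → Fin K × ℝ) × Fin K =>
      B.width (B.pastArm p.1) t p.2 :=
    measurable_from_prod_countable_left fun i => B.measurable_width_past t i
  have h2 := h1.comp ((H.measurable_history (t := t) (by omega)).prodMk
    (H.measurable_I t (Finset.mem_Icc.2 ⟨by omega, htn.2⟩)))
  convert! h2 using 2 with ω
  exact B.width_congr (B.pastArm_history ω) _

lemma integrable_width (ht : t ∈ Finset.Ioc τ n) (hs : B.OneSparse)
    (hinfo : ∀ᵐ ω ∂P, ∀ j, 1 ≤ B.info (fun ℓ => I ℓ ω) t j) :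
    Integrable (fun ω => B.width (fun ℓ => I ℓ ω) t (I t ω)) P := by
  refine Integrable.of_bound (H.measurable_width ht).aestronglyMeasurable 1 ?_
  filter_upwards [hinfo] with ω hω
  rw [Real.norm_eq_abs, abs_of_nonneg (B.width_nonneg _ _ _)]
  exact hs.width_le_one hω _

lemma integrable_gap (ht : t ∈ Finset.Icc 1 n) : Integrable (fun ω => B.gap (I t ω)) P := by
  refine Integrable.of_bound ((Measurable.of_discrete (f := B.gap)).comp
    (H.measurable_I t ht)).aestronglyMeasurable B.gapMax ?_
  refine Filter.Eventually.of_forall fun ω => ?_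
  rw [Real.norm_eq_abs, abs_of_nonneg (B.gap_nonneg _)]
  exact B.gap_le_gapMax _

end Integrable

section Round

variable (hs : B.OneSparse) (hb : BddAbove B.slopes) (hn : 7 ≤ n) (hd : 1 ≤ d)
  (hc₁ : c₁ = B.σ * B.slopeMin⁻¹ * √(confWidth d n)) (ha : a = c₁ * B.slopeMax)
  (hdn : d + 2 ≤ n)
include H ht hs hb hn hd hc₁ ha hdn

omit [IsProbabilityMeasure P] in
/-- Outside of the bad rounds the perturbed estimate is accurate. -/
lemma ae_estimate_close
    (hinfo : ∀ᵐ ω ∂P, ∀ j, 1 ≤ B.info (fun ℓ => I ℓ ω) t j ∧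
      8 * a ^ 2 * (B.slopeMin ^ 2)⁻¹ * Real.log n ≤ B.info (fun ℓ => I ℓ ω) t j) :
    ∀ᵐ ω ∂P, ω ∉ (⋃ j, bad B (B.radius c₁ n) Y Z I t j) → ∀ j,
      |θ' t ω j - B.θstar j| ≤ B.radius c₁ n / √(B.info (fun ℓ => I ℓ ω) t j) ∧
      (0 ≤ B.noise (fun ℓ => I ℓ ω) (fun ℓ => Y (I ℓ ω) ℓ ω) t j +
        B.score (fun ℓ => I ℓ ω) (fun ℓ => Z t ℓ ω) t j → B.θstar j ≤ θ' t ω j) ∧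
      (B.noise (fun ℓ => I ℓ ω) (fun ℓ => Y (I ℓ ω) ℓ ω) t j +
        B.score (fun ℓ => I ℓ ω) (fun ℓ => Z t ℓ ω) t j ≤ 0 → θ' t ω j ≤ B.θstar j) := by
  filter_upwards [hinfo, H.estimate t ht] with ω hω hest hgood
  have hpos : ∀ j, 0 < √(B.info (fun ℓ => I ℓ ω) t j) := fun j =>
    Real.sqrt_pos.2 (by linarith [(hω j).1])
  have hclose := hs.estimate_close (fun ℓ => I ℓ ω) (fun ℓ => Y (I ℓ ω) ℓ ω + Z t ℓ ω) t
    (ρ := fun j => B.radius c₁ n / √(B.info (fun ℓ => I ℓ ω) t j))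
    (fun j => (div_le_one (hpos j)).2
      (B.radius_le_sqrt hb hn hd hc₁ ha (by omega) (hω j).2))
    (fun j => by linarith [(hω j).1]) (fun j => by
      rw [B.score_add]
      have hj : ω ∉ bad B (B.radius c₁ n) Y Z I t j := fun h =>
        hgood (Set.mem_iUnion.2 ⟨j, h⟩)
      refine (not_lt.1 hj).trans (le_of_eq ?_)
      have := Real.sq_sqrt (show 0 ≤ B.info (fun ℓ => I ℓ ω) t j by linarith [(hω j).1])
      have := (hpos j).ne'
      rw [mul_assoc]
      congr 1
      rw [mul_div_assoc', eq_div_iff this]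
      linear_combination B.radius c₁ n *
        Real.sq_sqrt (show 0 ≤ B.info (fun ℓ => I ℓ ω) t j by linarith [(hω j).1]))
  intro j
  have := hclose.2 _ (hest hclose.1) j
  rwa [B.score_add] at this

/-- The expected regret of a round. -/
theorem integral_gap_le
    (hinfo : ∀ᵐ ω ∂P, ∀ j, 1 ≤ B.info (fun ℓ => I ℓ ω) t j ∧
      8 * a ^ 2 * (B.slopeMin ^ 2)⁻¹ * Real.log n ≤ B.info (fun ℓ => I ℓ ω) t j ∧
      B.info (fun ℓ => I ℓ ω) t j ≤ (n : ℝ) - d) :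
    ∫ ω, B.gap (I t ω) ∂P ≤
      B.gapMax * (2 / ((n : ℝ) - d + 1) + (1 / n + 2 / (((n : ℝ) - d + 1) * n))) +
      B.slopeMax * B.radius c₁ n * ((1 + 2 / (0.15 - 1 / n)) *
        ((∫ ω, B.width (fun ℓ => I ℓ ω) t (I t ω) ∂P) + 2 / (((n : ℝ) - d + 1) * n))) := by
  have htn : t ≤ n + 1 := by have := (Finset.mem_Ioc.1 ht).2; omega
  have htI : t ∈ Finset.Icc 1 n := by
    have := Finset.mem_Ioc.1 ht; exact Finset.mem_Icc.2 ⟨by omega, this.2⟩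
  have hdn' : d < n := by omega
  have hdnR : (d : ℝ) + 2 ≤ n := by exact_mod_cast hdn
  set C := B.radius c₁ n with hC
  have hC0 : 0 ≤ C := B.radius_nonneg hb hn hd hc₁ hdn'
  have ha0 := B.perturbation_scale_pos hb hn hd hc₁ ha hdn'
  obtain ⟨j, hj⟩ := hs.exists_coord hd B.best
  -- For a negative feature entry, overestimating the best arm means underestimating the coordinate.
  set v : ℝ := if 0 ≤ B.x B.best j then 1 else -1 with hv
  have hv' : v = 1 ∨ v = -1 := by rw [hv]; split_ifs <;> simp
  -- the event that the noise of the optimal arm is small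
  let A : Set (Finset.Ico 1 t → Fin K × ℝ) := {h | |B.noise (B.pastArm h) (pastReward h) t j| ≤
    B.σ * √(confWidth d n) * √(B.info (B.pastArm h) t j)}
  have hA : MeasurableSet A := measurableSet_le (B.measurable_noise_past t j).abs
    ((Real.continuous_sqrt.measurable.comp (B.measurable_info_past t j)).const_mul _)
  have hmemA : ∀ ω, history Y I t ω ∈ A ↔
      |B.noise (fun ℓ => I ℓ ω) (fun ℓ => Y (I ℓ ω) ℓ ω) t j| ≤
        B.σ * √(confWidth d n) * √(B.info (fun ℓ => I ℓ ω) t j) := by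
    intro ω
    rw [B.info_congr (B.pastArm_history (Y := Y) ω) j,
      B.noise_congr (B.pastArm_history ω) (pastReward_history ω) j]
    rfl
  -- Truncation at 1 keeps f bounded on every history; on sufficiently explored ones all widths are
  -- at most 1 and it has no effect.
  let f : (Finset.Ico 1 t → Fin K × ℝ) → ℝ :=
    A.indicator fun h => min 1 (B.minWidth C (B.pastArm h) t)
  have hf : Measurable f := (measurable_const.min (B.measurable_minWidth_past C t)).indicator hA
  have hf0 : ∀ h, 0 ≤ f h := fun h =>
    Set.indicator_nonneg (fun h _ => le_min zero_le_one (B.minWidth_nonneg)) h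
  have hf1 : ∀ h, f h ≤ 1 := fun h =>
    Set.indicator_le' (fun h _ => min_le_left _ _) (fun _ _ => zero_le_one) h
  let g : (Finset.Ico 1 t → Fin K × ℝ) → ℝ := Aᶜ.indicator fun _ => 1
  have hg : Measurable g := measurable_const.indicator hA.compl
  have hg0 : ∀ h, 0 ≤ g h := fun h => Set.indicator_nonneg (fun _ _ => zero_le_one) h
  have hg1 : ∀ h, g h ≤ 1 := fun h =>
    Set.indicator_le' (fun _ _ => le_rfl) (fun _ _ => zero_le_one) h
  set S := ⋃ j, bad B C Y Z I t j with hSdef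
  have hS : MeasurableSet S := MeasurableSet.iUnion fun j => H.measurableSet_bad _ ht j
  set E := optimistic B a v Z I t j with hE
  have hEm : MeasurableSet E := H.measurableSet_optimistic v ht j
  have hinfo1 : ∀ᵐ ω ∂P, ∀ j, 1 ≤ B.info (fun ℓ => I ℓ ω) t j ∧
      B.info (fun ℓ => I ℓ ω) t j ≤ (n : ℝ) - d := hinfo.mono fun ω h j => ⟨(h j).1, (h j).2.2⟩
  have hbadf := H.integral_indicator_bad_le ht hf hf0 hf1 hb hn hd hc₁ ha hdn hinfo1
  have hbad1 := H.integral_indicator_bad_le ht (f := fun _ => 1) measurable_const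
    (fun _ => zero_le_one) (fun _ => le_rfl) hb hn hd hc₁ ha hdn hinfo1
  have hopt := H.integral_indicator_optimistic_ge ht hf hf0 hf1 ha0 hv' j
    (hinfo.mono fun ω h => by linarith [(h j).1])
  rw [← hC, ← hSdef] at hbadf hbad1
  have hif := H.integrable_history ht hf hf0 hf1
  have hig := H.integrable_history ht hg hg0 hg1
  -- the noise of the optimal arm is large with a small probability
  have hgint : ∫ ω, g (history Y I t ω) ∂P ≤ 2 / ((n : ℝ) - d + 1) := by
    have hα0 : 0 ≤ 2 / ((n : ℝ) - d + 1) := div_nonneg zero_le_two (by linarith)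
    refine (ENNReal.ofReal_le_ofReal_iff hα0).1 ?_
    rw [ofReal_integral_eq_lintegral_ofReal hig (Filter.Eventually.of_forall fun ω => hg0 _)]
    calc ∫⁻ ω, ENNReal.ofReal (g (history Y I t ω)) ∂P
        ≤ ∫⁻ ω, ENNReal.ofReal (2 / ((n : ℝ) - d + 1)) *
          ENNReal.ofReal (mixture B.σ (B.info (fun ℓ => I ℓ ω) t j)
            (B.noise (fun ℓ => I ℓ ω) (fun ℓ => Y (I ℓ ω) ℓ ω) t j)) ∂P := by
          refine lintegral_mono_ae ?_
          filter_upwards [hinfo] with ω hω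
          rw [← ENNReal.ofReal_mul hα0]
          refine ENNReal.ofReal_le_ofReal ?_
          by_cases h : history Y I t ω ∈ A
          · have : g (history Y I t ω) = 0 :=
              Set.indicator_of_notMem (show history Y I t ω ∉ Aᶜ from fun hc => hc h) _
            rw [this]
            exact mul_nonneg hα0 (mixture_nonneg _ _ _)
          · have : g (history Y I t ω) = 1 := Set.indicator_of_mem h _
            rw [this]
            exact B.one_le_mixture hd hdn' hn (hω j).1 (hω j).2.2
              (not_le.1 fun hc => h ((hmemA ω).2 hc))
      _ ≤ ENNReal.ofReal (2 / ((n : ℝ) - d + 1)) * 1 := by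
          rw [lintegral_const_mul' _ _ ENNReal.ofReal_ne_top]
          exact mul_le_mul_right (H.lintegral_mixture_le j htn) _
      _ = _ := mul_one _
  have hwi := H.integrable_width ht hs (hinfo.mono fun ω h j => (h j).1)
  have hgapi := H.integrable_gap htI
  have hclose := H.ae_estimate_close ht hs hb hn hd hc₁ ha hdn
    (hinfo.mono fun ω h j => ⟨(h j).1, (h j).2.1⟩)
  have hfval : ∀ ω, (∀ j, 1 ≤ B.info (fun ℓ => I ℓ ω) t j) → history Y I t ω ∈ A →
      f (history Y I t ω) = B.minWidth C (fun ℓ => I ℓ ω) t := by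
    intro ω hω h
    have h1 : f (history Y I t ω) = min 1 (B.minWidth C (B.pastArm (history Y I t ω)) t) :=
      Set.indicator_of_mem h _
    rw [h1, ← B.minWidth_congr C (B.pastArm_history ω)]
    refine min_eq_right ?_
    obtain ⟨i, -, hi⟩ := B.exists_minWidth_eq hC0 (arm := fun ℓ => I ℓ ω) (t := t)
    rw [hi]
    exact hs.width_le_one hω i
  have hmax := B.slopeMax_pos hb
  -- an optimistic round explores
  have hexp : ∀ᵐ ω ∂P, E.indicator (fun ω => f (history Y I t ω)) ω ≤
      B.width (fun ℓ => I ℓ ω) t (I t ω) + S.indicator (fun ω => f (history Y I t ω)) ω := by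
    filter_upwards [hinfo, hclose, H.greedy t ht] with ω hω hcl hgr
    have hw0 := B.width_nonneg (fun ℓ => I ℓ ω) t (I t ω)
    by_cases hbadω : ω ∈ S
    · rw [Set.indicator_of_mem hbadω]
      have := Set.indicator_le_self' (s := E) (f := fun ω => f (history Y I t ω))
        (fun ω _ => hf0 _) ω
      linarith
    rw [Set.indicator_of_notMem hbadω, add_zero]
    by_cases hoptω : ω ∈ E
    swap
    · rwa [Set.indicator_of_notMem hoptω]
    rw [Set.indicator_of_mem hoptω]
    by_cases hAω : history Y I t ω ∈ A
    swap
    · have : f (history Y I t ω) = 0 := Set.indicator_of_notMem hAω _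
      rwa [this]
    rw [hfval ω (fun j => (hω j).1) hAω]
    have hcl' := hcl hbadω
    refine B.minWidth_le_width_greedy (fun j => (hcl' j).1) hgr ?_
    rw [hj, hj]
    have hN := abs_le.1 ((hmemA ω).1 hAω)
    have hW : a * √(B.info (fun ℓ => I ℓ ω) t j) ≤
      v * B.score (fun ℓ => I ℓ ω) (fun ℓ => Z t ℓ ω) t j := hoptω
    -- The scale a dominates the noise width, so an optimistic perturbation outweighs the noise and
    -- fixes the sign of the score.
    have hsc := mul_le_mul_of_nonneg_right (B.noise_scale_le hb hc₁ ha)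
      (Real.sqrt_nonneg (B.info (fun ℓ => I ℓ ω) t j))
    by_cases hx : 0 ≤ B.x B.best j
    · rw [hv, if_pos hx, one_mul] at hW
      exact mul_le_mul_of_nonneg_left ((hcl' j).2.1 (by linarith [hN.1])) hx
    · rw [hv, if_neg hx] at hW
      exact mul_le_mul_of_nonpos_left ((hcl' j).2.2 (by linarith [hN.2])) (not_le.1 hx).le
  -- the gap of the pulled arm
  have hgap : ∀ᵐ ω ∂P, B.gap (I t ω) ≤
      B.gapMax * (g (history Y I t ω) + S.indicator (fun _ => 1) ω) +
      B.slopeMax * C * (2 * f (history Y I t ω) + B.width (fun ℓ => I ℓ ω) t (I t ω)) := by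
    filter_upwards [hinfo, hclose, H.greedy t ht] with ω hω hcl hgr
    have hw0 := B.width_nonneg (fun ℓ => I ℓ ω) t (I t ω)
    have hM0 := B.gapMax_nonneg
    have hle := B.gap_le_gapMax (I t ω)
    have hr0 : 0 ≤ B.slopeMax * C *
        (2 * f (history Y I t ω) + B.width (fun ℓ => I ℓ ω) t (I t ω)) := by
      have := hf0 (history Y I t ω)
      positivity
    have hgω := hg0 (history Y I t ω)
    by_cases hbadω : ω ∈ S
    · rw [Set.indicator_of_mem hbadω]
      nlinarith [mul_nonneg hM0 hgω]
    rw [Set.indicator_of_notMem hbadω, add_zero]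
    by_cases hAω : history Y I t ω ∈ A
    swap
    · have : g (history Y I t ω) = 1 := Set.indicator_of_mem hAω _
      rw [this]
      linarith
    have hlin := B.linGap_greedy_le hC0 (fun j => (hcl hbadω j).1) hgr
    rw [hfval ω (fun j => (hω j).1) hAω]
    have h1 := (B.gap_le_slopeMax_mul hb (I t ω)).trans (mul_le_mul_of_nonneg_left hlin hmax.le)
    nlinarith [mul_nonneg hM0 hgω]
  have hSi : Integrable (S.indicator fun _ => (1 : ℝ)) P := (integrable_const _).indicator hS
  have hfSi : Integrable (S.indicator fun ω => f (history Y I t ω)) P := hif.indicator hS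
  have hfEi : Integrable (E.indicator fun ω => f (history Y I t ω)) P := hif.indicator hEm
  have hI1 := integral_mono_ae hfEi (hwi.add hfSi) hexp
  rw [integral_add' hwi hfSi] at hI1
  have hI2 := integral_mono_ae hgapi (((hig.add hSi).const_mul B.gapMax).add
    (((hif.const_mul 2).add hwi).const_mul (B.slopeMax * C))) hgap
  rw [integral_add' ((hig.add hSi).const_mul B.gapMax)
    (((hif.const_mul 2).add hwi).const_mul (B.slopeMax * C)), integral_const_mul,
    integral_const_mul, integral_add' hig hSi, integral_add' (hif.const_mul 2) hwi,
    integral_const_mul] at hI2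
  simp only [integral_const, probReal_univ, smul_eq_mul, mul_one] at hbad1
  set ε : ℝ := 2 / (((n : ℝ) - d + 1) * n)
  have hε : 0 ≤ ε := div_nonneg zero_le_two (mul_nonneg (by linarith) (Nat.cast_nonneg _))
  set U := ∫ ω, f (history Y I t ω) ∂P
  set w := ∫ ω, B.width (fun ℓ => I ℓ ω) t (I t ω) ∂P
  have hn' : (7 : ℝ) ≤ n := by exact_mod_cast hn
  have hden : 0 < 0.15 - 1 / (n : ℝ) := by
    have h1 : 1 / (n : ℝ) ≤ 1 / 7 := by gcongr
    norm_num at h1 ⊢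
    linarith
  -- Solves 0.15 U ≤ w + U/n + ε for U; the denominator is positive because n ≥ 7.
  have hU : U ≤ (w + ε) / (0.15 - 1 / n) := by
    rw [le_div_iff₀ hden]
    linarith
  have hfin : 2 * U + w ≤ (1 + 2 / (0.15 - 1 / n)) * (w + ε) := by
    have e : (1 + 2 / (0.15 - 1 / (n : ℝ))) * (w + ε) =
      w + ε + 2 * ((w + ε) / (0.15 - 1 / n)) := by ring
    rw [e]
    linarith
  refine hI2.trans (add_le_add (mul_le_mul_of_nonneg_left ?_ B.gapMax_nonneg)
    (mul_le_mul_of_nonneg_left hfin (mul_nonneg hmax.le hC0)))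
  linarith

end Round

end IsGLMFPL

end GLMBandit

/-! ### Summation over the rounds and the final bounds -/

namespace GLMBandit.IsGLMFPL

variable {d K : ℕ} {B : GLMBandit d K} {Ω : Type*} [MeasurableSpace Ω] {P : Measure Ω}
  [IsProbabilityMeasure P]
  {n τ : ℕ} {a c₁ : ℝ} {Y : Fin K → ℕ → Ω → ℝ} {Z : ℕ → ℕ → Ω → ℝ}
  {θ' : ℕ → Ω → EuclideanSpace ℝ (Fin d)} {I : ℕ → Ω → Fin K}
  (H : B.IsGLMFPL P n τ a Y Z θ' I)
include H

lemma regret_eq : B.regret P I n = ∑ t ∈ Finset.Icc 1 n, ∫ ω, B.gap (I t ω) ∂P := by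
  have hint : ∀ i, ∀ t ∈ Finset.Icc 1 n,
      Integrable (fun ω => if I t ω = i then (1 : ℝ) else 0) P := by
    intro i t ht
    refine Integrable.of_bound ((Measurable.of_discrete
      (f := fun k : Fin K => if k = i then (1 : ℝ) else 0)).comp
        (H.measurable_I t ht)).aestronglyMeasurable 1 ?_
    refine Filter.Eventually.of_forall fun ω => ?_
    split_ifs <;> simp
  unfold regret
  rw [Finset.sum_erase _ (by rw [B.gap_best, zero_mul])]
  have h1 : ∀ i, B.gap i * ∫ ω, ∑ t ∈ Finset.Icc 1 n, (if I t ω = i then (1 : ℝ) else 0) ∂P =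
      ∑ t ∈ Finset.Icc 1 n, ∫ ω, B.gap i * (if I t ω = i then (1 : ℝ) else 0) ∂P := by
    intro i
    rw [integral_finsetSum _ (hint i), Finset.mul_sum]
    exact Finset.sum_congr rfl fun t _ => (integral_const_mul _ _).symm
  simp_rw [h1]
  rw [Finset.sum_comm]
  refine Finset.sum_congr rfl fun t ht => ?_
  rw [← integral_finsetSum _ fun i _ => (hint i t ht).const_mul _]
  refine integral_congr_ae (Filter.Eventually.of_forall fun ω => ?_)
  simp

/-- The regret bound in terms of the radius of the confidence interval. -/
theorem regret_le (hs : B.OneSparse) (hb : BddAbove B.slopes) (hn : 7 ≤ n) (hd : 1 ≤ d)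
    (hτ : 1 ≤ τ) (hτn : τ ≤ n) (hdτ : d + 1 ≤ τ)
    (hc₁ : c₁ = B.σ * B.slopeMin⁻¹ * √(confWidth d n)) (ha : a = c₁ * B.slopeMax)
    (hinfo : ∀ᵐ ω ∂P, ∀ j, 1 ≤ B.info (fun ℓ => I ℓ ω) τ j ∧
      8 * a ^ 2 * (B.slopeMin ^ 2)⁻¹ * Real.log n ≤ B.info (fun ℓ => I ℓ ω) τ j) :
    B.regret P I n ≤ B.slopeMax * B.radius c₁ n * (1 + 2 / (0.15 - 1 / n)) *
      √(2 * d * n * Real.log (2 * n / d)) + (4 + τ) * B.gapMax := by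
  have hΔ := B.gapMax_nonneg
  have hround : ∀ t ∈ Finset.Ioc τ n, ∀ᵐ ω ∂P, ∀ j, 1 ≤ B.info (fun ℓ => I ℓ ω) t j ∧
      8 * a ^ 2 * (B.slopeMin ^ 2)⁻¹ * Real.log n ≤ B.info (fun ℓ => I ℓ ω) t j ∧
      B.info (fun ℓ => I ℓ ω) t j ≤ (n : ℝ) - d := by
    intro t ht
    obtain ⟨h1, h2⟩ := Finset.mem_Ioc.1 ht
    filter_upwards [hinfo] with ω hω j
    have hm : ∀ j, B.info (fun ℓ => I ℓ ω) τ j ≤ B.info (fun ℓ => I ℓ ω) t j :=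
      B.info_mono _ h1.le
    exact ⟨(hω j).1.trans (hm j), (hω j).2.trans (hm j),
      B.info_le_sub _ (by omega) h2 (fun j => (hω j).1.trans (hm j)) j⟩
  have hsplit : Finset.Icc 1 n = Finset.Icc 1 τ ∪ Finset.Ioc τ n := by
    ext t
    simp only [Finset.mem_Icc, Finset.mem_union, Finset.mem_Ioc]
    omega
  have hdisj : Disjoint (Finset.Icc 1 τ) (Finset.Ioc τ n) := by
    rw [Finset.disjoint_left]
    intro t h1 h2
    simp only [Finset.mem_Icc, Finset.mem_Ioc] at h1 h2
    omega
  have hexplore : ∑ t ∈ Finset.Icc 1 τ, ∫ ω, B.gap (I t ω) ∂P ≤ τ * B.gapMax := by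
    have h1 : ∀ t ∈ Finset.Icc 1 τ, ∫ ω, B.gap (I t ω) ∂P ≤ B.gapMax := by
      intro t ht
      have ht' : t ∈ Finset.Icc 1 n := Finset.Icc_subset_Icc_right hτn ht
      have := integral_mono (H.integrable_gap ht') (integrable_const B.gapMax)
        fun ω => B.gap_le_gapMax (I t ω)
      simpa using this
    refine (Finset.sum_le_sum h1).trans ?_
    simp
  rw [H.regret_eq, hsplit, Finset.sum_union hdisj]
  set ε : ℝ := 2 / (((n : ℝ) - d + 1) * n) with hε
  set D : ℝ := B.slopeMax * B.radius c₁ n * (1 + 2 / (0.15 - 1 / n)) with hD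
  have hgreedy : ∑ t ∈ Finset.Ioc τ n, ∫ ω, B.gap (I t ω) ∂P ≤
      4 * B.gapMax + D * √(2 * d * n * Real.log (2 * n / d)) := by
    -- If τ = n there are no greedy rounds. Otherwise d + 1 ≤ τ < n supplies d + 2 ≤ n, which the
    -- bound for one round needs.
    rcases hτn.eq_or_lt with h | hlt
    · have hn' : (7 : ℝ) ≤ n := by exact_mod_cast hn
      have hden : 0 < 0.15 - 1 / (n : ℝ) := by
        have h1 : 1 / (n : ℝ) ≤ 1 / 7 := by gcongr
        norm_num at h1 ⊢
        linarith
      have := B.slopeMax_pos hb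
      have := B.radius_nonneg hb hn hd hc₁ (by omega)
      rw [h, Finset.Ioc_self, Finset.sum_empty]
      positivity
    · have hn' : (7 : ℝ) ≤ n := by exact_mod_cast hn
      have hden : 0 < 0.15 - 1 / (n : ℝ) := by
        have h1 : 1 / (n : ℝ) ≤ 1 / 7 := by gcongr
        norm_num at h1 ⊢
        linarith
      have hD0 : 0 ≤ D := by
        have := B.slopeMax_pos hb
        have := B.radius_nonneg hb hn hd hc₁ (by omega)
        positivity
      have h1 := Finset.sum_le_sum fun t ht =>
        H.integral_gap_le ht hs hb hn hd hc₁ ha (by omega) (hround t ht)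
      refine h1.trans ?_
      have hwsum : ∑ t ∈ Finset.Ioc τ n, ∫ ω, B.width (fun ℓ => I ℓ ω) t (I t ω) ∂P ≤
          √(2 * d * n * Real.log (n / d)) := by
        have hwi : ∀ t ∈ Finset.Ioc τ n,
            Integrable (fun ω => B.width (fun ℓ => I ℓ ω) t (I t ω)) P := fun t ht =>
          H.integrable_width ht hs ((hround t ht).mono fun ω h j => (h j).1)
        rw [← integral_finsetSum _ hwi]
        have h2 := integral_mono_ae (integrable_finsetSum _ hwi)
          (integrable_const (√(2 * d * n * Real.log (n / d))))
          (hinfo.mono fun ω h => hs.sum_width_le (arm := fun ℓ => I ℓ ω) hd hτ hτn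
            fun j => (h j).1)
        simpa using h2
      have hcard : ((Finset.Ioc τ n).card : ℝ) = ((n - τ : ℕ) : ℝ) := by rw [Nat.card_Ioc]
      obtain ⟨f1, f2⟩ := failure_sum_le (d := d) (n := n) (k := n - τ) (by omega) hn
      rw [Finset.sum_add_distrib, Finset.sum_const, nsmul_eq_mul, hcard]
      have e : ∀ t, B.slopeMax * B.radius c₁ n * ((1 + 2 / (0.15 - 1 / (n : ℝ))) *
          ((∫ ω, B.width (fun ℓ => I ℓ ω) t (I t ω) ∂P) + ε)) =
          D * ((∫ ω, B.width (fun ℓ => I ℓ ω) t (I t ω) ∂P) + ε) := fun t => by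
        rw [hD]; ring
      simp_rw [← hε, e]
      rw [← Finset.mul_sum, Finset.sum_add_distrib, Finset.sum_const, nsmul_eq_mul, hcard]
      have h3 := sqrt_add_two_div_le hd (show d < n by omega) hn
      refine add_le_add ?_ (mul_le_mul_of_nonneg_left (by linarith) hD0)
      have := mul_le_mul_of_nonneg_right f1 hΔ
      linarith
  linarith

end GLMBandit.IsGLMFPL

theorem mainTheorem2 :
    ∃ M : ℝ → ℝ → ℝ → ℝ,
      ∀ (d K n τ : ℕ) (B : GLMBandit d K)
        (Ω : Type*) [MeasurableSpace Ω] (P : Measure Ω) [IsProbabilityMeasure P]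
        (Y : Fin K → ℕ → Ω → ℝ) (Z : ℕ → ℕ → Ω → ℝ)
        (θ' : ℕ → Ω → EuclideanSpace ℝ (Fin d)) (I : ℕ → Ω → Fin K)
        (a c₁ c₂ : ℝ),
        1 ≤ d → 7 ≤ n → 1 ≤ τ → τ ≤ n →
        -- the maximum derivative of the mean function is finite
        BddAbove B.slopes →
        -- every feature vector has at most one non-zero entry
        (∀ i j k, B.x i j ≠ 0 → B.x i k ≠ 0 → j = k) →
        c₁ = B.σ * B.slopeMin⁻¹ * √(d * Real.log (n / d) + 2 * Real.log n) →
        c₂ = c₁ * B.slopeMin⁻¹ * B.slopeMax * √(2 * Real.log (K * n)) →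
        a = c₁ * B.slopeMax →
        B.IsGLMFPL P n τ a Y Z θ' I →
        (∀ᵐ ω ∂P,
          max (4 * B.σ ^ 2 * (B.slopeMin ^ 2)⁻¹ * (d * Real.log (n / d) + 2 * Real.log n))
            (max (8 * a ^ 2 * (B.slopeMin ^ 2)⁻¹ * Real.log n) 1)
          ≤ lambdaMin (B.gram (fun ℓ => I ℓ ω) τ)) →
        B.regret P I n ≤
            B.slopeMax * (c₁ + c₂) * (1 + 2 / (0.15 - 1 / n)) *
              √(2 * d * n * Real.log (2 * n / d)) + (4 + τ) * B.gapMax ∧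
          B.regret P I n ≤
            M B.σ B.slopeMin B.slopeMax * (d * √(n * Real.log K)) * Real.log n ^ (3 / 2 : ℝ) +
              (4 + τ) * B.gapMax := by
  refine ⟨fun σ lo hi => 1124 * hi * (σ * lo⁻¹) * (1 + 3 * (lo⁻¹ * hi)), ?_⟩
  intro d K n τ B Ω _ P _ Y Z θ' I a c₁ c₂ hd hn hτ hτn hb hsp hc₁ hc₂ ha H hmin
  have hs : B.OneSparse := hsp
  have hinfo : ∀ᵐ ω ∂P, ∀ j, 1 ≤ B.info (fun ℓ => I ℓ ω) τ j ∧
      8 * a ^ 2 * (B.slopeMin ^ 2)⁻¹ * Real.log n ≤ B.info (fun ℓ => I ℓ ω) τ j := by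
    filter_upwards [hmin] with ω hω j
    have h1 := hω.trans (hs.lambdaMin_gram_le _ τ j)
    exact ⟨((le_max_right _ _).trans (le_max_right _ _)).trans h1,
      ((le_max_left _ _).trans (le_max_right _ _)).trans h1⟩
  -- The relations d + 1 ≤ τ and d ≤ K are deterministic, so a single typical outcome proves them.
  obtain ⟨ω₀, hω₀⟩ := hinfo.exists
  have hdτ : d + 1 ≤ τ := B.dim_add_one_le _ hτ fun j => (hω₀ j).1
  have hdK : d ≤ K := hs.dim_le_card _ fun j => (hω₀ j).1
  have hn' : (7 : ℝ) ≤ n := by exact_mod_cast hn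
  have hd' : (1 : ℝ) ≤ d := by exact_mod_cast hd
  have hdK' : (d : ℝ) ≤ K := by exact_mod_cast hdK
  have hden : 0 < 0.15 - 1 / (n : ℝ) := by
    have h1 : 1 / (n : ℝ) ≤ 1 / 7 := by gcongr
    norm_num at h1 ⊢
    linarith
  have hmax := B.slopeMax_pos hb
  have hlo := B.slopeMin_pos
  have hc₁0 : 0 < c₁ := B.c₁_pos hn hd hc₁ (by omega)
  have hrad : B.radius c₁ n ≤ c₁ + c₂ := by
    have h1 : √(2 * Real.log (d * n)) ≤ √(2 * Real.log (K * n)) := by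
      gcongr
    have h2 : c₁ * B.slopeMin⁻¹ * B.slopeMax * √(2 * Real.log (d * n)) ≤ c₂ := by
      rw [hc₂]
      gcongr
    unfold GLMBandit.radius
    linarith
  have hfirst : B.regret P I n ≤ B.slopeMax * (c₁ + c₂) * (1 + 2 / (0.15 - 1 / n)) *
      √(2 * d * n * Real.log (2 * n / d)) + (4 + τ) * B.gapMax := by
    refine (H.regret_le hs hb hn hd hτ hτn hdτ hc₁ ha hinfo).trans ?_
    gcongr
  refine ⟨hfirst, ?_⟩
  rcases Nat.lt_or_ge K 2 with hK | hK
  -- With one arm log K = 0 and the rate term vanishes, but so does the regret.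
  · have hK1 : K = 1 := by omega
    subst hK1
    have h0 : ∀ i, B.gap i = 0 := fun i => by
      rw [Subsingleton.elim i B.best, B.gap_best]
    have hreg : B.regret P I n = 0 := by simp [GLMBandit.regret, h0]
    have hΔ := B.gapMax_nonneg
    rw [hreg]
    simp only [Nat.cast_one, Real.log_one, mul_zero, Real.sqrt_zero, zero_mul, zero_add]
    positivity
  · exact hfirst.trans (add_le_add_left (regret_rate_le hd (by omega) hn hK B.σ_pos hlo hmax
      hc₁ hc₂) _)
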